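/- Let $E=(E^0,E^1,r,s)$ be a directed graph with countable vertex set $E^0$ and countable edge set $E^1$ (range map $r$, source map $s$), let $K$ be a field, and let $L_K(E)$ be the Leavitt path algebra of $E$, that is, the universal (not necessarily unital) associative $K$-algebra generated by pairwise orthogonal idempotents $v$ $(v\in E^0)$ and elements $e,e^*$ $(e\in E^1)$ subject to $s(e)e=er(e)=e$, $r(e)e^*=e^*s(e)=e^*$, $e^*f=\delta_{e,f}\,r(e)$ for $e,f\in E^1$, and $v=\sum_{s(e)=v}ee^*$ whenever $0<|s^{-1}(v)|<\infty$. A *closed path based at* $v$ is a path $e_1\cdots e_n$ with $n\ge 1$ from $v$ to $v$; it is a *closed simple path* if $s(e_i)\neq s(e_1)$ for $i>1$. $E$ satisfies *Condition (K)* if every vertex is the base of no closed path or of at least two distinct closed simple paths. Write $v\ge w$ if there is a path (possibly of length $0$) from $v$ to $w$. A *maximal tail* is a nonempty set $M\subseteq E^0$ such that - if $v\in E^0$, $w\in M$ and $v\ge w$, then $v\in M$; - if $v\in M$ and $0<|s^{-1}(v)|<\infty$, then there is an edge $e$ with $s(e)=v$ and $r(e)\in M$; - for all $v,w\in M$ there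 is $y\in M$ with $v\ge y$ and $w\ge y$. For $\emptyset\neq X\subseteq E^0$ let $\Omega(X)=\{w\in E^0\setminus X : w\not\ge v \text{ for every } v\in X\}$, and write $\Omega(v)=\Omega(\{v\})$. For $H\subseteq E^0$ let $$B_H=\{v\in E^0\setminus H : |s^{-1}(v)|=\infty \text{ and } 0<|s^{-1}(v)\cap r^{-1}(E^0\setminus H)|<\infty\},$$ and $v^H=v-\sum_{s(e)=v,\ r(e)\notin H}ee^*$ for $v\in B_H$. For $S\subseteq B_H$ let $I(H,S)$ be the two-sided ideal of $L_K(E)$ generated by $\{v: v\in H\}\cup\{v^H: v\in S\}$. A *breaking vertex* is a vertex $v$ with $v\in B_{\Omega(v)}$. A two-sided ideal $P\neq L_K(E)$ is *prime* if, for all two-sided ideals $J_1,J_2$, $J_1J_2\subseteq P$ implies $J_1\subseteq P$ or $J_2\subseteq P$. Suppose that $E$ satisfies Condition (K). Then the set of all prime ideals of $L_K(E)$ is $$\{I(\Omega(M),B_{\Omega(M)}) : M \text{ a maximal tail in } E\}\ \cup\ \{I(\Omega(v),B_{\Omega(v)}\setminus\{v\}) : v \text{ a breaking vertex of } E\}.$$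 In particular, if $E^0\neq\emptyset$, every maximal tail in $E$ equals $E^0$, and $E$ has no breaking vertices, then $L_K(E)$ is simple, i.e. its multiplication is not identically zero and its only two-sided ideals are $0$ and $L_K(E)\neq 0$. -/

import Mathlib

universe u₁ u₂ u₃ u₄

/-- A directed graph (loops and multiple edges allowed) with vertex set `V`, edge set `E`,
source map `src` and range map `rng`. -/
structure DirGraph (V : Type u₁) (E : Type u₂) where
  src : E → V
  rng : E → V

namespace DirGraph

section Combinatorics

variable {V : Type u₁} {E : Type u₂} (G : DirGraph V E)

/-- The set of edges emitted by the vertex `v`. -/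
def out (v : V) : Set E := {e | G.src e = v}

/-- `G.IsPath v α w`: the list of edges `α = e₁ … eₙ` is a path from `v` to `w`.
The empty list is the path of length zero at a vertex. -/
def IsPath : V → List E → V → Prop
  | v, [], w => v = w
  | v, e :: α, w => G.src e = v ∧ IsPath (G.rng e) α w

/-- `v ≥ w`: there is a path, possibly of length zero, from `v` to `w`. -/
def Reaches (v w : V) : Prop := ∃ α : List E, G.IsPath v α w

/-- A closed path based at `v`: a path of positive length from `v` to `v`. -/
def IsClosedPath (v : V) (α : List E) : Prop := α ≠ [] ∧ G.IsPath v α v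

/-- A closed simple path based at `v`: a closed path `e₁ … eₙ` based at `v` such that
`s(eᵢ) ≠ s(e₁) = v` for all `i > 1`. -/
def IsClosedSimplePath (v : V) (α : List E) : Prop :=
  G.IsClosedPath v α ∧ ∀ e ∈ α.tail, G.src e ≠ v

/-- Condition (K): every vertex is the base of no closed path or of at least two distinct
closed simple paths. -/
def ConditionK : Prop :=
  ∀ v : V, (¬ ∃ α, G.IsClosedPath v α) ∨
    ∃ α β, α ≠ β ∧ G.IsClosedSimplePath v α ∧ G.IsClosedSimplePath v β

/-- Maximal tails: nonempty sets of vertices with the properties (MT1), (MT2), (MT3). -/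
structure IsMaximalTail (M : Set V) : Prop where
  nonempty : M.Nonempty
  mt1 : ∀ v : V, ∀ w ∈ M, G.Reaches v w → v ∈ M
  mt2 : ∀ v ∈ M, (G.out v).Nonempty → (G.out v).Finite → ∃ e : E, G.src e = v ∧ G.rng e ∈ M
  mt3 : ∀ v ∈ M, ∀ w ∈ M, ∃ y ∈ M, G.Reaches v y ∧ G.Reaches w y

/-- `Ω(X)`: the vertices outside `X` from which no vertex of `X` can be reached. -/
def Omega (X : Set V) : Set V := {w | w ∉ X ∧ ∀ v ∈ X, ¬ G.Reaches w v}

/-- The edges emitted by `v` whose range is not in `H`. -/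
def outAvoiding (H : Set V) (v : V) : Set E := {e | G.src e = v ∧ G.rng e ∉ H}

/-- `B_H`: the infinite emitters outside `H` that emit a nonzero finite number of edges
into the complement of `H`. -/
def BH (H : Set V) : Set V :=
  {v | v ∉ H ∧ (G.out v).Infinite ∧ (G.outAvoiding H v).Nonempty ∧ (G.outAvoiding H v).Finite}

/-- The set of breaking vertices: the (infinite emitters) `v` with `v ∈ B_{Ω(v)}`. -/
def BV : Set V := {v | v ∈ G.BH (G.Omega {v})}

/-- A Leavitt family of the graph `G` in a (not necessarily unital) ring: pairwise orthogonal
idempotents `a v`, together with elements `b e` and `b' e` (standing for `e` and `e*`). -/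
structure IsLeavittFamily {A : Type u₃} [NonUnitalRing A] (a : V → A) (b b' : E → A) :
    Prop where
  idem : ∀ v, a v * a v = a v
  orth : ∀ v w, v ≠ w → a v * a w = 0
  src_mul : ∀ e, a (G.src e) * b e = b e
  mul_rng : ∀ e, b e * a (G.rng e) = b e
  rng_mul : ∀ e, a (G.rng e) * b' e = b' e
  mul_src : ∀ e, b' e * a (G.src e) = b' e
  ghost_mul_self : ∀ e, b' e * b e = a (G.rng e)
  ghost_mul_ne : ∀ e f, e ≠ f → b' e * b f = 0
  sum_eq : ∀ v (h : (G.out v).Finite), (G.out v).Nonempty →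
    ∑ e ∈ h.toFinset, b e * b' e = a v

end Combinatorics

section Algebra

variable (K : Type u₃) [CommRing K] {V : Type u₁} {E : Type u₂} (G : DirGraph V E)

/-- The symbols that generate the Leavitt path algebra: vertices, real edges, ghost edges. -/
inductive Gen (V : Type u₁) (E : Type u₂) : Type (max u₁ u₂)
  | vertex (v : V) : Gen V E
  | edge (e : E) : Gen V E
  | ghost (e : E) : Gen V E

/-- The class of the vertex `v` in the free algebra. -/
noncomputable def fv (E : Type u₂) (v : V) : FreeAlgebra K (Gen V E) :=
  FreeAlgebra.ι K (Gen.vertex v)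

/-- The class of the real edge `e` in the free algebra. -/
noncomputable def fe (V : Type u₁) (e : E) : FreeAlgebra K (Gen V E) :=
  FreeAlgebra.ι K (Gen.edge e)

/-- The class of the ghost edge `e*` in the free algebra. -/
noncomputable def fg (V : Type u₁) (e : E) : FreeAlgebra K (Gen V E) :=
  FreeAlgebra.ι K (Gen.ghost e)

/-- The defining relations of a Leavitt family, in the free unital algebra on the symbols. -/
inductive Rel : FreeAlgebra K (Gen V E) → FreeAlgebra K (Gen V E) → Prop
  | idem (v : V) : Rel (fv K E v * fv K E v) (fv K E v)
  | orth (v w : V) : v ≠ w → Rel (fv K E v * fv K E w) 0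
  | src_mul (e : E) : Rel (fv K E (G.src e) * fe K V e) (fe K V e)
  | mul_rng (e : E) : Rel (fe K V e * fv K E (G.rng e)) (fe K V e)
  | rng_mul (e : E) : Rel (fv K E (G.rng e) * fg K V e) (fg K V e)
  | mul_src (e : E) : Rel (fg K V e * fv K E (G.src e)) (fg K V e)
  | ghost_mul_self (e : E) : Rel (fg K V e * fe K V e) (fv K E (G.rng e))
  | ghost_mul_ne (e f : E) : e ≠ f → Rel (fg K V e * fe K V f) 0
  | sum_eq (v : V) (h : (G.out v).Finite) : (G.out v).Nonempty →
      Rel (∑ e ∈ h.toFinset, fe K V e * fg K V e) (fv K E v)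

/-- The universal *unital* `K`-algebra generated by a Leavitt family (it is the Leavitt path
algebra with a unit adjoined). -/
abbrev UnitalLeavitt : Type _ := RingQuot (Rel K G)

/-- The image of a generating symbol in `UnitalLeavitt K G`. -/
noncomputable def gen (x : Gen V E) : UnitalLeavitt K G :=
  RingQuot.mkAlgHom K (Rel K G) (FreeAlgebra.ι K x)

/-- The Leavitt path algebra `L_K(G)`: the (in general non-unital) `K`-algebra generated by the
vertices, real edges and ghost edges. That it is the universal `K`-algebra generated by a Leavitt
family is proved in `isLeavittFamily` and `existsUnique_hom` below. -/
def LPA : Type _ := NonUnitalAlgebra.adjoin K (Set.range (gen K G))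

noncomputable instance : NonUnitalRing (LPA K G) :=
  inferInstanceAs (NonUnitalRing (NonUnitalAlgebra.adjoin K (Set.range (gen K G))))

noncomputable instance : Module K (LPA K G) :=
  inferInstanceAs (Module K (NonUnitalAlgebra.adjoin K (Set.range (gen K G))))

instance : IsScalarTower K (LPA K G) (LPA K G) :=
  inferInstanceAs (IsScalarTower K (NonUnitalAlgebra.adjoin K (Set.range (gen K G)))
    (NonUnitalAlgebra.adjoin K (Set.range (gen K G))))

instance : SMulCommClass K (LPA K G) (LPA K G) :=
  inferInstanceAs (SMulCommClass K (NonUnitalAlgebra.adjoin K (Set.range (gen K G)))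
    (NonUnitalAlgebra.adjoin K (Set.range (gen K G))))

/-- The inclusion of `L_K(G)` into the universal unital algebra. -/
noncomputable def incl : LPA K G →ₙₐ[K] UnitalLeavitt K G :=
  NonUnitalSubalgebraClass.subtype (NonUnitalAlgebra.adjoin K (Set.range (gen K G)))

theorem incl_injective : Function.Injective (incl K G) := Subtype.val_injective

/-- A generating symbol as an element of `L_K(G)`. -/
noncomputable def lgen (x : Gen V E) : LPA K G :=
  ⟨gen K G x, NonUnitalAlgebra.subset_adjoin K ⟨x, rfl⟩⟩

/-- The vertex `v` as an element of `L_K(G)`. -/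
noncomputable def vtx (v : V) : LPA K G := lgen K G (Gen.vertex v)

/-- The real edge `e` as an element of `L_K(G)`. -/
noncomputable def edg (e : E) : LPA K G := lgen K G (Gen.edge e)

/-- The ghost edge `e*` as an element of `L_K(G)`. -/
noncomputable def gho (e : E) : LPA K G := lgen K G (Gen.ghost e)

/-- `v^H = v - ∑ e e*`, the sum over the edges `e` with `s(e) = v` and `r(e) ∉ H`; for
`v ∈ B_H` there are finitely many of these. -/
noncomputable def gap (H : Set V) (v : V) : LPA K G :=
  vtx K G v - ∑ᶠ e ∈ G.outAvoiding H v, edg K G e * gho K G e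

/-- `I(H, S)`: the two-sided ideal of `L_K(G)` generated by the vertices `v ∈ H` and the
elements `v^H` with `v ∈ S`. -/
noncomputable def idealHS (H S : Set V) : TwoSidedIdeal (LPA K G) :=
  TwoSidedIdeal.span (vtx K G '' H ∪ gap K G H '' S)

theorem incl_lgen (x : Gen V E) : incl K G (lgen K G x) = gen K G x := rfl

/-- `L_K(G)` is generated by the symbols. -/
theorem LPA.induction {p : LPA K G → Prop} (hgen : ∀ x, p (lgen K G x)) (hzero : p 0)
    (hadd : ∀ x y, p x → p y → p (x + y)) (hmul : ∀ x y, p x → p y → p (x * y))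
    (hsmul : ∀ (r : K) x, p x → p (r • x)) (x : LPA K G) : p x := by
  have key : ∀ (y : UnitalLeavitt K G) (hy : y ∈ NonUnitalAlgebra.adjoin K (Set.range (gen K G))),
      p (⟨y, hy⟩ : NonUnitalAlgebra.adjoin K (Set.range (gen K G))) := by
    intro y hy
    refine NonUnitalAlgebra.adjoin_induction (p := fun y hy =>
      p (⟨y, hy⟩ : NonUnitalAlgebra.adjoin K (Set.range (gen K G)))) ?_ ?_ hzero ?_ ?_ hy
    · rintro _ ⟨z, rfl⟩
      exact hgen z
    · exact fun a b _ _ ha hb => hadd _ _ ha hb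
    · exact fun a b _ _ ha hb => hmul _ _ ha hb
    · exact fun r a _ ha => hsmul r _ ha
  exact key x.1 x.2

theorem isLeavittFamily : G.IsLeavittFamily (vtx K G) (edg K G) (gho K G) where
  idem v := incl_injective K G <| by
    simpa [incl_lgen, vtx, edg, gho, gen, fv] using RingQuot.mkAlgHom_rel K (Rel.idem (K := K) (G := G) v)
  orth v w h := incl_injective K G <| by
    simpa [incl_lgen, vtx, edg, gho, gen, fv] using RingQuot.mkAlgHom_rel K (Rel.orth (K := K) (G := G) v w h)
  src_mul e := incl_injective K G <| by
    simpa [incl_lgen, vtx, edg, gho, gen, fv, fe] using RingQuot.mkAlgHom_rel K (Rel.src_mul (K := K) (G := G) e)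
  mul_rng e := incl_injective K G <| by
    simpa [incl_lgen, vtx, edg, gho, gen, fv, fe] using RingQuot.mkAlgHom_rel K (Rel.mul_rng (K := K) (G := G) e)
  rng_mul e := incl_injective K G <| by
    simpa [incl_lgen, vtx, edg, gho, gen, fv, fg] using RingQuot.mkAlgHom_rel K (Rel.rng_mul (K := K) (G := G) e)
  mul_src e := incl_injective K G <| by
    simpa [incl_lgen, vtx, edg, gho, gen, fv, fg] using RingQuot.mkAlgHom_rel K (Rel.mul_src (K := K) (G := G) e)
  ghost_mul_self e := incl_injective K G <| by
    simpa [incl_lgen, vtx, edg, gho, gen, fv, fe, fg] using RingQuot.mkAlgHom_rel K (Rel.ghost_mul_self (K := K) (G := G) e)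
  ghost_mul_ne e f h := incl_injective K G <| by
    simpa [incl_lgen, edg, gho, gen, fe, fg] using RingQuot.mkAlgHom_rel K (Rel.ghost_mul_ne (K := K) (G := G) e f h)
  sum_eq v h hne := incl_injective K G <| by
    have := RingQuot.mkAlgHom_rel K (Rel.sum_eq (K := K) (G := G) v h hne)
    simpa [incl_lgen, vtx, edg, gho, gen, fv, fe, fg, map_sum] using this

variable {A : Type u₄} [NonUnitalRing A] [Module K A] [IsScalarTower K A A] [SMulCommClass K A A]

/-- The universal property of `L_K(G)`: every Leavitt family in a (not necessarily unital)
associative `K`-algebra is the image of the canonical one under a unique homomorphism. -/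
theorem existsUnique_hom {a : V → A} {b b' : E → A} (h : G.IsLeavittFamily a b b') :
    ∃! φ : LPA K G →ₙₐ[K] A,
      (∀ v, φ (vtx K G v) = a v) ∧ (∀ e, φ (edg K G e) = b e) ∧ ∀ e, φ (gho K G e) = b' e := by
  let g : Gen V E → A := fun x => match x with
    | Gen.vertex v => a v
    | Gen.edge e => b e
    | Gen.ghost e => b' e
  let F : FreeAlgebra K (Gen V E) →ₐ[K] Unitization K A :=
    FreeAlgebra.lift K fun x => (g x : Unitization K A)
  have hF : ∀ ⦃x y⦄, Rel K G x y → F x = F y := by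
    intro x y hxy
    cases hxy with
    | idem v => simp [F, g, fv, ← Unitization.inr_mul, h.idem]
    | orth v w hvw => simp [F, g, fv, ← Unitization.inr_mul, h.orth v w hvw]
    | src_mul e => simp [F, g, fv, fe, ← Unitization.inr_mul, h.src_mul]
    | mul_rng e => simp [F, g, fv, fe, ← Unitization.inr_mul, h.mul_rng]
    | rng_mul e => simp [F, g, fv, fg, ← Unitization.inr_mul, h.rng_mul]
    | mul_src e => simp [F, g, fv, fg, ← Unitization.inr_mul, h.mul_src]
    | ghost_mul_self e => simp [F, g, fv, fe, fg, ← Unitization.inr_mul, h.ghost_mul_self]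
    | ghost_mul_ne e f hef => simp [F, g, fe, fg, ← Unitization.inr_mul, h.ghost_mul_ne e f hef]
    | sum_eq v hf hne =>
      have := congrArg (Unitization.inrNonUnitalAlgHom K A) (h.sum_eq v hf hne)
      simpa [F, g, fv, fe, fg, map_sum] using this
  let Φ : UnitalLeavitt K G →ₐ[K] Unitization K A := RingQuot.liftAlgHom K ⟨F, hF⟩
  have hΦ : ∀ x, Φ (gen K G x) = (g x : Unitization K A) := by
    intro x
    simp [Φ, gen, F, RingQuot.liftAlgHom_mkAlgHom_apply]
  have hfst : ∀ x : LPA K G, (Φ (incl K G x)).fst = 0 := by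
    intro x
    induction x using LPA.induction with
    | hgen x => simp [incl_lgen, hΦ]
    | hzero => simp
    | hadd x y hx hy => simp_all
    | hmul x y hx hy => simp_all
    | hsmul r x hx => simp_all
  let φ : LPA K G →ₙₐ[K] A :=
    { toFun := fun x => (Φ (incl K G x)).snd
      map_smul' := fun r x => by simp
      map_zero' := by simp
      map_add' := fun x y => by simp
      map_mul' := fun x y => by simp [hfst] }
  refine ⟨φ, ⟨fun v => ?_, fun e => ?_, fun e => ?_⟩, ?_⟩
  · simp [φ, vtx, incl_lgen, hΦ, g]
  · simp [φ, edg, incl_lgen, hΦ, g]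
  · simp [φ, gho, incl_lgen, hΦ, g]
  · rintro ψ ⟨h1, h2, h3⟩
    have hgen : ∀ x, ψ (lgen K G x) = g x := by
      rintro (v | e | e)
      exacts [h1 v, h2 e, h3 e]
    ext x
    induction x using LPA.induction with
    | hgen x => exact (hgen x).trans (by simp [φ, incl_lgen, hΦ])
    | hzero => rw [map_zero, map_zero]
    | hadd x y hx hy => rw [map_add, map_add, hx, hy]
    | hmul x y hx hy => rw [map_mul, map_mul, hx, hy]
    | hsmul r x hx => rw [map_smul, map_smul, hx]

end Algebra

end DirGraph

/-- Prime (two-sided) ideals of a not necessarily commutative or unital ring: proper ideals `P`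
such that `J₁ J₂ ⊆ P` implies `J₁ ⊆ P` or `J₂ ⊆ P` for all two-sided ideals `J₁`, `J₂`. -/
def IsPrimeTwoSided {A : Type u₁} [NonUnitalRing A] (P : TwoSidedIdeal A) : Prop :=
  P ≠ ⊤ ∧ ∀ J₁ J₂ : TwoSidedIdeal A,
    (∀ x ∈ J₁, ∀ y ∈ J₂, x * y ∈ P) → J₁ ≤ P ∨ J₂ ≤ P

/-! The engine is a reduction theorem, `ConditionK.compressible`. Let H be the set of vertices in an
ideal `I`. Under Condition (K), any element outside `I` can be multiplied on both sides into a
vertex or some v^H with v ∈ B_H, modulo `I`, without falling into `I`. Ghost edges are removed by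
multiplying by edges. If that always leads into `I`, the element is congruent to y v^H with y a
combination of real paths. A ghost path then turns y into a nonzero multiple of a vertex plus closed
paths. Condition (K) kills the closed paths by conjugation, or v^H kills them modulo `I`.

Hence every ideal is generated by its vertices and its elements v^H (`ConditionK.eq_idealHS`).
Conversely, a representation of the algebra shows that I(H,S) contains no further vertices or
elements v^H (`exists_representation`, `idealHS_spec`).

Primeness then becomes combinatorial. An ideal is prime if all ideals not below it share an
idempotent modulo it, pairwise. For a maximal tail this is a common lower bound of two vertices; for
a breaking vertex it is v^H. Conversely, for a prime P the vertices outside P form a maximal tail.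
At most one v^H lies outside P, and if one does, every vertex outside P reaches v, so H = Ω(v).
Simplicity follows because every proper ideal lies in a prime, and the only prime available is 0. -/

namespace DirGraph

/-! ### Closed paths, prefixes and Condition (K) -/

section Paths

variable {V : Type u₁} {E : Type u₂} {G : DirGraph V E}

theorem IsPath.append {u v w : V} {α β : List E} (hα : G.IsPath u α v) (hβ : G.IsPath v β w) :
    G.IsPath u (α ++ β) w := by
  induction α generalizing u with
  | nil => cases hα; exact hβ
  | cons e α ih => exact ⟨hα.1, ih hα.2⟩

theorem IsPath.of_append {u v w : V} {α β : List E} (hα : G.IsPath u α v)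
    (h : G.IsPath u (α ++ β) w) : G.IsPath v β w := by
  induction α generalizing u with
  | nil => cases hα; exact h
  | cons e α ih => exact ih hα.2 h.2

theorem Reaches.refl (v : V) : G.Reaches v v := ⟨[], rfl⟩

theorem Reaches.trans {u v w : V} (h₁ : G.Reaches u v) (h₂ : G.Reaches v w) : G.Reaches u w := by
  obtain ⟨α, hα⟩ := h₁
  obtain ⟨β, hβ⟩ := h₂
  exact ⟨_, hα.append hβ⟩

theorem reaches_of_edge (e : E) : G.Reaches (G.src e) (G.rng e) := ⟨[e], rfl, rfl⟩

/-- No proper nonempty prefix of a closed simple path is closed. -/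
theorem IsClosedSimplePath.eq_of_prefix {v : V} {c γ : List E} (hc : G.IsClosedSimplePath v c)
    (hγ : G.IsClosedPath v γ) (h : γ <+: c) : γ = c := by
  obtain ⟨ρ, rfl⟩ := h
  cases ρ with
  | nil => simp
  | cons e ρ =>
    -- The edge following the closed prefix starts at `v`, which simplicity forbids after the first
    -- edge.
    refine absurd (hγ.2.of_append hc.1.2).1 (hc.2 e ?_)
    obtain ⟨a, γ', rfl⟩ := List.exists_cons_of_ne_nil hγ.1
    simp

/-- A closed simple path that is a prefix of `γ ++ c`, for a closed path `γ`, is a prefix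
of `γ`. -/
theorem IsClosedSimplePath.prefix_of_prefix_append {v : V} {c γ : List E}
    (hc : G.IsClosedSimplePath v c) (hγ : G.IsClosedPath v γ) (h : c <+: γ ++ c) : c <+: γ := by
  rcases le_total c.length γ.length with hl | hl
  · exact List.prefix_of_prefix_length_le h (List.prefix_append _ _) hl
  · rw [hc.eq_of_prefix hγ (List.prefix_of_prefix_length_le (List.prefix_append _ _) h hl)]

/-- Under Condition (K), no closed path `γ` is compatible with all closed paths at its base. -/
theorem ConditionK.exists_not_prefix (hK : G.ConditionK) {v : V} {γ : List E}
    (hγ : G.IsClosedPath v γ) : ∃ c, G.IsClosedPath v c ∧ ¬ c <+: γ ++ c := by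
  rcases hK v with h | ⟨c₁, c₂, hne, h₁, h₂⟩
  · exact absurd ⟨γ, hγ⟩ h
  -- Otherwise both closed simple paths are prefixes of `γ`, hence comparable, hence equal.
  · by_contra! h
    have p₁ := h₁.prefix_of_prefix_append hγ (h c₁ h₁.1)
    have p₂ := h₂.prefix_of_prefix_append hγ (h c₂ h₂.1)
    rcases List.prefix_or_prefix_of_prefix p₁ p₂ with p | p
    · exact hne (h₂.eq_of_prefix h₁.1 p)
    · exact hne (h₁.eq_of_prefix h₂.1 p).symm

end Paths

/-! ### Monomials αβ* and local units -/

section PathElements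

variable (K : Type u₃) [Field K] {V : Type u₁} {E : Type u₂} (G : DirGraph V E)

/-- The real path `α` starting at `u`, as an element of the Leavitt path algebra. -/
noncomputable def realPath : V → List E → LPA K G
  | u, [] => vtx K G u
  | u, e :: α => vtx K G u * edg K G e * realPath (G.rng e) α

/-- The ghost path `α*`, for a path `α` starting at `u`. -/
noncomputable def ghostPath : V → List E → LPA K G
  | u, [] => vtx K G u
  | u, e :: α => ghostPath (G.rng e) α * gho K G e * vtx K G u

variable {K G}

@[simp] theorem vtx_mul_self (v : V) : vtx K G v * vtx K G v = vtx K G v :=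
  (isLeavittFamily K G).idem v

theorem vtx_mul_ne {v w : V} (h : v ≠ w) : vtx K G v * vtx K G w = 0 :=
  (isLeavittFamily K G).orth v w h

@[simp] theorem edg_mul_vtx (e : E) : edg K G e * vtx K G (G.rng e) = edg K G e :=
  (isLeavittFamily K G).mul_rng e

@[simp] theorem vtx_mul_edg (e : E) : vtx K G (G.src e) * edg K G e = edg K G e :=
  (isLeavittFamily K G).src_mul e

@[simp] theorem vtx_mul_gho (e : E) : vtx K G (G.rng e) * gho K G e = gho K G e :=
  (isLeavittFamily K G).rng_mul e

@[simp] theorem gho_mul_vtx (e : E) : gho K G e * vtx K G (G.src e) = gho K G e :=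
  (isLeavittFamily K G).mul_src e

@[simp] theorem gho_mul_edg_self (e : E) : gho K G e * edg K G e = vtx K G (G.rng e) :=
  (isLeavittFamily K G).ghost_mul_self e

theorem gho_mul_edg_ne {e f : E} (h : e ≠ f) : gho K G e * edg K G f = 0 :=
  (isLeavittFamily K G).ghost_mul_ne e f h

@[simp] theorem vtx_mul_realPath (u : V) (α : List E) :
    vtx K G u * realPath K G u α = realPath K G u α := by
  cases α <;> simp [realPath, ← mul_assoc]

@[simp] theorem ghostPath_mul_vtx (u : V) (α : List E) :
    ghostPath K G u α * vtx K G u = ghostPath K G u α := by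
  cases α <;> simp [ghostPath, mul_assoc]

theorem realPath_append {u v : V} {α : List E} (hα : G.IsPath u α v) (β : List E) :
    realPath K G u (α ++ β) = realPath K G u α * realPath K G v β := by
  induction α generalizing u with
  | nil => cases hα; simp [realPath]
  | cons e α ih => simp [realPath, ih hα.2, mul_assoc]

theorem ghostPath_append {u v : V} {α : List E} (hα : G.IsPath u α v) (β : List E) :
    ghostPath K G u (α ++ β) = ghostPath K G v β * ghostPath K G u α := by
  induction α generalizing u with
  | nil => cases hα; simp [ghostPath]
  | cons e α ih => simp [ghostPath, ih hα.2, mul_assoc]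

theorem realPath_mul_vtx {u v : V} {α : List E} (hα : G.IsPath u α v) :
    realPath K G u α * vtx K G v = realPath K G u α := by
  simpa [realPath] using (realPath_append (K := K) hα []).symm

theorem realPath_singleton (e : E) : realPath K G (G.src e) [e] = edg K G e := by
  simp [realPath]

theorem ghostPath_singleton (e : E) : ghostPath K G (G.src e) [e] = gho K G e := by
  simp [ghostPath]

theorem ghostPath_cons_mul_realPath_cons {e f : E} (h : G.src f = G.src e) (α α' : List E) :
    ghostPath K G (G.src e) (e :: α) * realPath K G (G.src e) (f :: α') =
      ghostPath K G (G.rng e) α * ((gho K G e * edg K G f) * realPath K G (G.rng f) α') := by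
  have hf : vtx K G (G.src e) * edg K G f = edg K G f := by rw [← h, vtx_mul_edg]
  simp only [ghostPath, realPath, hf, mul_assoc]
  rw [← mul_assoc (vtx K G (G.src e)), hf]

theorem ghostPath_mul_realPath {u v : V} {α : List E} (hα : G.IsPath u α v) :
    ghostPath K G u α * realPath K G u α = vtx K G v := by
  induction α generalizing u with
  | nil => cases hα; simp [ghostPath, realPath]
  | cons e α ih =>
    obtain ⟨rfl, hα⟩ := hα
    rw [← ih hα]
    rw [ghostPath_cons_mul_realPath_cons rfl, gho_mul_edg_self, vtx_mul_realPath]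

/-- Products of a ghost path and a real path that is not shorter. -/
theorem ghostPath_mul_realPath_of_le {u u' v v' : V} {α α' : List E} (hα : G.IsPath u α v)
    (hα' : G.IsPath u' α' v') (hl : α.length ≤ α'.length) :
    ghostPath K G u α * realPath K G u' α' = 0 ∨
      u = u' ∧ ∃ γ, α' = α ++ γ ∧ G.IsPath v γ v' ∧
        ghostPath K G u α * realPath K G u' α' = realPath K G v γ := by
  by_cases huu : u = u'
  swap
  · left
    rw [← ghostPath_mul_vtx, ← vtx_mul_realPath, mul_assoc, ← mul_assoc (vtx K G u),
      vtx_mul_ne huu, zero_mul, mul_zero]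
  subst huu
  by_cases hp : α <+: α'
  · obtain ⟨γ, rfl⟩ := hp
    refine Or.inr ⟨rfl, γ, rfl, hα.of_append hα', ?_⟩
    rw [realPath_append hα, ← mul_assoc, ghostPath_mul_realPath hα, vtx_mul_realPath]
  · left
    induction α generalizing u α' with
    | nil => simp at hp
    | cons e α ih =>
      cases α' with
      | nil => simp at hl
      | cons f α' =>
        obtain ⟨rfl, hα⟩ := hα
        rw [ghostPath_cons_mul_realPath_cons hα'.1]
        by_cases hef : e = f
        · subst hef
          rw [gho_mul_edg_self, vtx_mul_realPath]
          refine ih hα (by simpa using hl) hα'.2 fun h => hp ?_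
          simpa using h
        · rw [gho_mul_edg_ne hef, zero_mul, mul_zero]

/-- Products of a ghost path and a real path that is not longer. -/
theorem ghostPath_mul_realPath_of_ge {u u' v v' : V} {α α' : List E} (hα : G.IsPath u α v)
    (hα' : G.IsPath u' α' v') (hl : α'.length ≤ α.length) :
    ghostPath K G u α * realPath K G u' α' = 0 ∨
      u = u' ∧ ∃ γ, α = α' ++ γ ∧ G.IsPath v' γ v ∧
        ghostPath K G u α * realPath K G u' α' = ghostPath K G v' γ := by
  by_cases huu : u = u'
  swap
  · left
    rw [← ghostPath_mul_vtx, ← vtx_mul_realPath, mul_assoc, ← mul_assoc (vtx K G u),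
      vtx_mul_ne huu, zero_mul, mul_zero]
  subst huu
  by_cases hp : α' <+: α
  · obtain ⟨γ, rfl⟩ := hp
    refine Or.inr ⟨rfl, γ, rfl, hα'.of_append hα, ?_⟩
    rw [ghostPath_append hα', mul_assoc, ghostPath_mul_realPath hα', ghostPath_mul_vtx]
  · left
    induction α' generalizing u α with
    | nil => simp at hp
    | cons f α' ih =>
      cases α with
      | nil => simp at hl
      | cons e α =>
        obtain ⟨rfl, hα⟩ := hα
        rw [ghostPath_cons_mul_realPath_cons hα'.1]
        by_cases hef : e = f
        · subst hef
          rw [gho_mul_edg_self, vtx_mul_realPath]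
          refine ih hα (by simpa using hl) hα'.2 fun h => hp ?_
          simpa using h
        · rw [gho_mul_edg_ne hef, zero_mul, mul_zero]

/-- The Leavitt path algebra is spanned by the elements `αβ*`. -/
theorem span_monomials_eq_top :
    Submodule.span K {x | ∃ u α u' β w, G.IsPath u α w ∧ G.IsPath u' β w ∧
      x = realPath K G u α * ghostPath K G u' β} = ⊤ := by
  set S := {x | ∃ u α u' β w, G.IsPath u α w ∧ G.IsPath u' β w ∧
      x = realPath K G u α * ghostPath K G u' β} with hS
  rw [Submodule.eq_top_iff']
  intro x
  induction x using LPA.induction with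
  | hgen x =>
    apply Submodule.subset_span
    rcases x with v | e | e
    · exact ⟨v, [], v, [], v, rfl, rfl, (vtx_mul_self (K := K) (G := G) v).symm⟩
    · refine ⟨G.src e, [e], G.rng e, [], G.rng e, ⟨rfl, rfl⟩, rfl, ?_⟩
      rw [realPath_singleton, ghostPath, edg_mul_vtx, edg]
    · refine ⟨G.rng e, [], G.src e, [e], G.rng e, rfl, ⟨rfl, rfl⟩, ?_⟩
      rw [ghostPath_singleton, realPath, vtx_mul_gho, gho]
  | hzero => exact zero_mem _
  | hadd x y hx hy => exact add_mem hx hy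
  | hsmul r x hx => exact Submodule.smul_mem _ _ hx
  | hmul x y hx hy =>
    induction hx using Submodule.span_induction with
    | zero => simp
    | add x x' _ _ h h' => rw [add_mul]; exact add_mem h h'
    | smul r x _ h => rw [smul_mul_assoc]; exact Submodule.smul_mem _ _ h
    | mem x hx =>
      induction hy using Submodule.span_induction with
      | zero => simp
      | add x x' _ _ h h' => rw [mul_add]; exact add_mem h h'
      | smul r x _ h => rw [mul_smul_comm]; exact Submodule.smul_mem _ _ h
      | mem y hy =>
        obtain ⟨u, α, u', β, w, hα, hβ, rfl⟩ := hx
        obtain ⟨t, γ, t', δ, z, hγ, hδ, rfl⟩ := hy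
        have key : realPath K G u α * ghostPath K G u' β *
            (realPath K G t γ * ghostPath K G t' δ) = realPath K G u α *
            (ghostPath K G u' β * realPath K G t γ) * ghostPath K G t' δ := by
          simp only [mul_assoc]
        rw [key]
        rcases le_total β.length γ.length with hl | hl
        · rcases ghostPath_mul_realPath_of_le (K := K) hβ hγ hl with h | ⟨-, τ, -, hτ, h⟩
          · simp [h]
          · rw [h, ← realPath_append hα]
            exact Submodule.subset_span ⟨_, _, _, _, _, hα.append hτ, hδ, rfl⟩
        · rcases ghostPath_mul_realPath_of_ge (K := K) hβ hγ hl with h | ⟨-, τ, -, hτ, h⟩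
          · simp [h]
          · rw [h, mul_assoc, ← ghostPath_append hδ]
            exact Submodule.subset_span ⟨_, _, _, _, _, hα, hδ.append hτ, rfl⟩

theorem sum_vtx_mul_of_subset {F F' : Finset V} (h : F ⊆ F') :
    (∑ v ∈ F, vtx K G v) * ∑ v ∈ F', vtx K G v = ∑ v ∈ F, vtx K G v := by
  classical
  rw [Finset.sum_mul]
  refine Finset.sum_congr rfl fun v hv => ?_
  rw [Finset.mul_sum, Finset.sum_eq_single_of_mem v (h hv), vtx_mul_self]
  exact fun w _ hw => vtx_mul_ne hw.symm

/-- The finite sums of vertices are local right units. -/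
theorem exists_mul_sum_vtx_eq (x : LPA K G) : ∃ F : Finset V, x * ∑ v ∈ F, vtx K G v = x := by
  classical
  induction x using LPA.induction with
  | hgen x =>
    rcases x with v | e | e
    · exact ⟨{v}, by rw [Finset.sum_singleton]; exact vtx_mul_self v⟩
    · exact ⟨{G.rng e}, by rw [Finset.sum_singleton]; exact edg_mul_vtx e⟩
    · exact ⟨{G.src e}, by rw [Finset.sum_singleton]; exact gho_mul_vtx e⟩
  | hzero => exact ⟨∅, by simp⟩
  | hadd x y hx hy =>
    obtain ⟨F, hF⟩ := hx
    obtain ⟨F', hF'⟩ := hy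
    refine ⟨F ∪ F', ?_⟩
    conv_lhs => rw [← hF, ← hF']
    rw [add_mul, mul_assoc, mul_assoc, sum_vtx_mul_of_subset Finset.subset_union_left,
      sum_vtx_mul_of_subset Finset.subset_union_right, hF, hF']
  | hmul x y _ hy =>
    obtain ⟨F, hF⟩ := hy
    exact ⟨F, by rw [mul_assoc, hF]⟩
  | hsmul r x hx =>
    obtain ⟨F, hF⟩ := hx
    exact ⟨F, by rw [smul_mul_assoc, hF]⟩

/-- A `TwoSidedIdeal` is only a ring ideal; local units let the scalar be absorbed into a right
factor. -/
theorem smul_mem_ideal (I : TwoSidedIdeal (LPA K G)) (k : K) {x : LPA K G} (hx : x ∈ I) :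
    k • x ∈ I := by
  obtain ⟨F, hF⟩ := exists_mul_sum_vtx_eq x
  rw [← hF, ← mul_smul_comm]
  exact I.mul_mem_right _ _ hx

theorem exists_mul_vtx_notMem {I : TwoSidedIdeal (LPA K G)} {x : LPA K G} (hx : x ∉ I) :
    ∃ v, x * vtx K G v ∉ I := by
  by_contra! h
  obtain ⟨F, hF⟩ := exists_mul_sum_vtx_eq x
  rw [← hF, Finset.mul_sum] at hx
  exact hx (sum_mem fun v _ => h v)

end PathElements

/-! ### Ghost degree and combinations of real paths -/

section Compression

variable {K : Type u₃} [Field K] {V : Type u₁} {E : Type u₂} {G : DirGraph V E}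

/-- The span of the elements `αβ*` where `β` starts at `v` and has length at most `N`. -/
noncomputable def ghostDegreeLE (K : Type u₃) [Field K] (G : DirGraph V E) (N : ℕ) (v : V) :
    Submodule K (LPA K G) :=
  Submodule.span K {x | ∃ u α β w, G.IsPath u α w ∧ G.IsPath v β w ∧ β.length ≤ N ∧
    x = realPath K G u α * ghostPath K G v β}

/-- The span of the real paths that end at `v`. -/
noncomputable def realPathsTo (K : Type u₃) [Field K] (G : DirGraph V E) (v : V) :
    Submodule K (LPA K G) :=
  Submodule.span K ((fun p : V × List E => realPath K G p.1 p.2) '' {p | G.IsPath p.1 p.2 v})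

/-- The span of the closed paths based at `v`. -/
noncomputable def closedPathsAt (K : Type u₃) [Field K] (G : DirGraph V E) (v : V) :
    Submodule K (LPA K G) :=
  Submodule.span K {x | ∃ γ, G.IsClosedPath v γ ∧ x = realPath K G v γ}

theorem ghostDegreeLE_mono {N N' : ℕ} (h : N ≤ N') (v : V) :
    ghostDegreeLE K G N v ≤ ghostDegreeLE K G N' v := by
  refine Submodule.span_mono ?_
  rintro _ ⟨u, α, β, w, hα, hβ, hl, rfl⟩
  exact ⟨u, α, β, w, hα, hβ, hl.trans h, rfl⟩

theorem ghostDegreeLE_zero (v : V) : ghostDegreeLE K G 0 v ≤ realPathsTo K G v := by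
  refine Submodule.span_le.2 ?_
  rintro _ ⟨u, α, β, w, hα, hβ, hl, rfl⟩
  obtain rfl : β = [] := by simpa using hl
  cases hβ
  exact Submodule.subset_span ⟨(u, α), hα, by simp [ghostPath, realPath_mul_vtx hα]⟩

theorem mul_vtx_of_mem_ghostDegreeLE {N : ℕ} {v : V} {x : LPA K G}
    (hx : x ∈ ghostDegreeLE K G N v) : x * vtx K G v = x := by
  induction hx using Submodule.span_induction with
  | zero => simp
  | add x y _ _ hx hy => rw [add_mul, hx, hy]
  | smul k x _ hx => rw [smul_mul_assoc, hx]
  | mem x hx =>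
    obtain ⟨u, α, β, w, -, -, -, rfl⟩ := hx
    rw [mul_assoc, ghostPath_mul_vtx]

theorem mul_vtx_of_mem_realPathsTo {v : V} {x : LPA K G}
    (hx : x ∈ realPathsTo K G v) : x * vtx K G v = x := by
  induction hx using Submodule.span_induction with
  | zero => simp
  | add x y _ _ hx hy => rw [add_mul, hx, hy]
  | smul k x _ hx => rw [smul_mul_assoc, hx]
  | mem x hx =>
    obtain ⟨p, hp, rfl⟩ := hx
    exact realPath_mul_vtx hp

theorem mul_edg_mem_realPathsTo {e : E} {x : LPA K G} (hx : x ∈ realPathsTo K G (G.src e)) :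
    x * edg K G e ∈ realPathsTo K G (G.rng e) := by
  induction hx using Submodule.span_induction with
  | zero => simp
  | add x y _ _ hx hy => rw [add_mul]; exact add_mem hx hy
  | smul k x _ hx => rw [smul_mul_assoc]; exact Submodule.smul_mem _ _ hx
  | mem x hx =>
    obtain ⟨p, hp, rfl⟩ := hx
    refine Submodule.subset_span ⟨(p.1, p.2 ++ [e]), IsPath.append hp ⟨rfl, rfl⟩, ?_⟩
    simp only [realPath_append hp, realPath_singleton]

theorem realPathsTo_le (N : ℕ) (v : V) : realPathsTo K G v ≤ ghostDegreeLE K G N v := by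
  refine Submodule.span_le.2 ?_
  rintro _ ⟨p, hp, rfl⟩
  exact Submodule.subset_span ⟨p.1, p.2, [], v, hp, rfl, by simp,
    by simp [ghostPath, realPath_mul_vtx hp]⟩

theorem exists_mul_vtx_mem_ghostDegreeLE (x : LPA K G) (v : V) :
    ∃ N, x * vtx K G v ∈ ghostDegreeLE K G N v := by
  have hx := (span_monomials_eq_top (K := K) (G := G)).ge (Submodule.mem_top (x := x))
  induction hx using Submodule.span_induction with
  | zero => exact ⟨0, by simp⟩
  | add x y _ _ hx hy =>
    obtain ⟨N, hN⟩ := hx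
    obtain ⟨N', hN'⟩ := hy
    exact ⟨max N N', by
      rw [add_mul]
      exact add_mem (ghostDegreeLE_mono (le_max_left _ _) _ hN)
        (ghostDegreeLE_mono (le_max_right _ _) _ hN')⟩
  | smul k x _ hx =>
    obtain ⟨N, hN⟩ := hx
    exact ⟨N, by rw [smul_mul_assoc]; exact Submodule.smul_mem _ _ hN⟩
  | mem x hx =>
    obtain ⟨u, α, u', β, w, hα, hβ, rfl⟩ := hx
    by_cases h : u' = v
    · subst h
      exact ⟨β.length, Submodule.subset_span ⟨u, α, β, w, hα, hβ, le_rfl, by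
        rw [mul_assoc, ghostPath_mul_vtx]⟩⟩
    · refine ⟨0, ?_⟩
      rw [mul_assoc, ← ghostPath_mul_vtx, mul_assoc, vtx_mul_ne h]
      simp

/-- Splitting off the part of ghost degree zero. -/
theorem exists_eq_add_sum {N : ℕ} {v : V} {x : LPA K G} (hx : x ∈ ghostDegreeLE K G (N + 1) v) :
    ∃ y ∈ realPathsTo K G v, ∃ z : E →₀ LPA K G,
      (∀ e, z e ∈ ghostDegreeLE K G N (G.rng e)) ∧ (∀ e, G.src e ≠ v → z e = 0) ∧
        x = y + z.sum fun e t => t * gho K G e := by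
  classical
  induction hx using Submodule.span_induction with
  | zero => exact ⟨0, zero_mem _, 0, by simp, by simp, by simp⟩
  | add x x' _ _ hx hx' =>
    obtain ⟨y, hy, z, hz, hzv, rfl⟩ := hx
    obtain ⟨y', hy', z', hz', hzv', rfl⟩ := hx'
    refine ⟨y + y', add_mem hy hy', z + z', fun e => add_mem (hz e) (hz' e),
      fun e he => by simp [hzv e he, hzv' e he], ?_⟩
    rw [Finsupp.sum_add_index' (by simp) (by simp [add_mul])]
    abel
  | smul k x _ hx =>
    obtain ⟨y, hy, z, hz, hzv, rfl⟩ := hx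
    refine ⟨k • y, Submodule.smul_mem _ _ hy, k • z, fun e => Submodule.smul_mem _ _ (hz e),
      fun e he => by simp [hzv e he], ?_⟩
    rw [Finsupp.sum_smul_index' (by simp), smul_add, Finsupp.smul_sum]
    simp only [smul_mul_assoc]
  | mem x hx =>
    obtain ⟨u, α, β, w, hα, hβ, hl, rfl⟩ := hx
    cases β with
    | nil =>
      cases hβ
      exact ⟨_, Submodule.subset_span ⟨(u, α), hα, rfl⟩, 0, by simp, by simp,
        by simp [ghostPath, realPath_mul_vtx hα]⟩
    | cons e β =>
      obtain ⟨rfl, hβ⟩ := hβ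
      refine ⟨0, zero_mem _, Finsupp.single e (realPath K G u α * ghostPath K G (G.rng e) β),
        fun f => ?_, fun f hf => ?_, ?_⟩
      · by_cases hf : e = f
        · subst hf
          rw [Finsupp.single_eq_same]
          exact Submodule.subset_span ⟨u, α, β, w, hα, hβ, by simpa using hl, rfl⟩
        · rw [Finsupp.single_eq_of_ne' hf]
          exact zero_mem _
      · exact Finsupp.single_eq_of_ne' fun h => hf (h ▸ rfl)
      · rw [Finsupp.sum_single_index (by simp)]
        simp [ghostPath, mul_assoc]

/-- A nonzero combination of real paths ending at `v` is compressed to a combination of `v` and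
closed paths at `v`, with nonzero coefficient of `v`. -/
theorem exists_mul_eq_smul_vtx_add {v : V} {y : LPA K G} (hy : y ∈ realPathsTo K G v)
    (hy0 : y ≠ 0) : ∃ s, ∃ k : K, k ≠ 0 ∧ ∃ r ∈ closedPathsAt K G v,
      s * y = k • vtx K G v + r := by
  classical
  obtain ⟨c, hc, rfl⟩ := (Finsupp.mem_span_image_iff_linearCombination K).1 hy
  have hc0 : c.support.Nonempty := by
    rw [Finsupp.support_nonempty_iff]
    rintro rfl
    simp at hy0
  -- Multiplying by the ghost of a shortest path sends every other path to 0 or to a closed path of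
  -- positive length.
  obtain ⟨p, hp, hmin⟩ := Finset.exists_min_image c.support (fun p => p.2.length) hc0
  have hpath : ∀ q ∈ c.support, G.IsPath q.1 q.2 v := fun q hq => hc hq
  refine ⟨ghostPath K G p.1 p.2, c p, Finsupp.mem_support_iff.1 hp,
    ∑ q ∈ c.support.erase p, c q • (ghostPath K G p.1 p.2 * realPath K G q.1 q.2), ?_, ?_⟩
  · refine sum_mem fun q hq => Submodule.smul_mem _ _ ?_
    obtain ⟨hqp, hq⟩ := Finset.mem_erase.1 hq
    rcases ghostPath_mul_realPath_of_le (K := K) (hpath p hp) (hpath q hq) (hmin q hq) with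
      h | ⟨h1, γ, h2, hγ, h⟩
    · rw [h]
      exact zero_mem _
    · rw [h]
      refine Submodule.subset_span ⟨γ, ⟨?_, hγ⟩, rfl⟩
      rintro rfl
      exact hqp (Prod.ext h1.symm (by simpa using h2))
  · rw [Finsupp.linearCombination_apply, Finsupp.sum, Finset.mul_sum]
    simp only [mul_smul_comm]
    rw [← Finset.add_sum_erase _ _ hp, ghostPath_mul_realPath (hpath p hp)]

/-- Conjugation of a closed path `γ` by a closed path. -/
theorem conj_realPath {v : V} {γ δ : List E} (hγ : G.IsClosedPath v γ) (hδ : G.IsPath v δ v) :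
    ghostPath K G v δ * realPath K G v γ * realPath K G v δ = 0 ∨
      δ <+: γ ++ δ ∧ ∃ τ, G.IsClosedPath v τ ∧
        ghostPath K G v δ * realPath K G v γ * realPath K G v δ = realPath K G v τ := by
  rw [mul_assoc, ← realPath_append hγ.2]
  rcases ghostPath_mul_realPath_of_le (K := K) hδ (hγ.2.append hδ) (by simp) with
    h | ⟨-, τ, h2, hτ, h⟩
  · exact Or.inl h
  · refine Or.inr ⟨⟨τ, h2.symm⟩, τ, ⟨?_, hτ⟩, h⟩
    rintro rfl
    exact hγ.1 (by simpa using h2)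

theorem conj_append {v : V} {δ : List E} (hδ : G.IsPath v δ v) (δ' : List E) (x : LPA K G) :
    ghostPath K G v (δ ++ δ') * x * realPath K G v (δ ++ δ') =
      ghostPath K G v δ' * (ghostPath K G v δ * x * realPath K G v δ) * realPath K G v δ' := by
  rw [ghostPath_append hδ, realPath_append hδ]
  simp only [mul_assoc]

/-- Under Condition (K), combinations of closed paths are annihilated by conjugation with a
suitable path. -/
theorem exists_conj_eq_zero (hK : G.ConditionK) {v : V} {r : LPA K G}
    (hr : r ∈ closedPathsAt K G v) : ∀ δ, G.IsPath v δ v → ∃ δ', G.IsPath v δ' v ∧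
      ghostPath K G v (δ ++ δ') * r * realPath K G v (δ ++ δ') = 0 := by
  -- The induction is uniform in `δ`: after one summand is killed, the path is extended to kill the
  -- next, and what is already 0 stays 0.
  induction hr using Submodule.span_induction with
  | zero => exact fun δ _ => ⟨[], rfl, by simp⟩
  | smul k x _ hx =>
    intro δ hδ
    obtain ⟨δ', hδ', h⟩ := hx δ hδ
    exact ⟨δ', hδ', by rw [mul_smul_comm, smul_mul_assoc, h, smul_zero]⟩
  | add x y _ _ hx hy =>
    intro δ hδ
    obtain ⟨δ', hδ', h⟩ := hx δ hδ
    obtain ⟨δ'', hδ'', h'⟩ := hy (δ ++ δ') (hδ.append hδ')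
    refine ⟨δ' ++ δ'', hδ'.append hδ'', ?_⟩
    rw [← List.append_assoc, mul_add, add_mul, h', conj_append (hδ.append hδ'), h]
    simp
  | mem x hx =>
    obtain ⟨γ, hγ, rfl⟩ := hx
    intro δ hδ
    rcases conj_realPath (K := K) hγ hδ with h | ⟨-, τ, hτ, h⟩
    · exact ⟨[], rfl, by rw [List.append_nil, h]⟩
    -- c*τc vanishes unless `c` is a prefix of τc, and Condition (K) supplies a `c` that is not.
    · obtain ⟨c, hc, hcτ⟩ := hK.exists_not_prefix hτ
      refine ⟨c, hc.2, ?_⟩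
      rw [conj_append hδ, h]
      exact (conj_realPath hτ hc.2).resolve_right fun h => hcτ h.1

/-- Almost all ghost edges annihilate a given combination of closed paths. -/
theorem finite_gho_mul_ne_zero {v : V} {r : LPA K G} (hr : r ∈ closedPathsAt K G v) :
    {e | gho K G e * r ≠ 0}.Finite := by
  induction hr using Submodule.span_induction with
  | zero => simp
  | smul k x _ hx =>
    refine hx.subset fun e he h => he ?_
    rw [mul_smul_comm, h, smul_zero]
  | add x y _ _ hx hy =>
    refine (hx.union hy).subset fun e he => ?_
    by_contra h
    simp only [Set.mem_union, Set.mem_ofPred_eq, not_or, not_not] at h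
    exact he (by rw [mul_add, h.1, h.2, add_zero])
  | mem x hx =>
    obtain ⟨γ, hγ, rfl⟩ := hx
    obtain ⟨f, γ, rfl⟩ := List.exists_cons_of_ne_nil hγ.1
    -- Only the ghost of the first edge of the path can survive.
    refine (Set.finite_singleton f).subset fun e he => ?_
    by_contra h
    refine he ?_
    obtain rfl := hγ.2.1
    rw [realPath, vtx_mul_edg, ← mul_assoc, gho_mul_edg_ne h, zero_mul]

/-! ### The idempotents v^H -/

theorem gap_eq_sub_sum {H : Set V} {v : V} (h : (G.outAvoiding H v).Finite) :
    gap K G H v = vtx K G v - ∑ e ∈ h.toFinset, edg K G e * gho K G e := by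
  rw [gap, finsum_mem_eq_finite_toFinset_sum _ h]

theorem vtx_mul_gap {H : Set V} {v : V} (h : (G.outAvoiding H v).Finite) :
    vtx K G v * gap K G H v = gap K G H v := by
  rw [gap_eq_sub_sum h, mul_sub, vtx_mul_self, Finset.mul_sum]
  congr 1
  refine Finset.sum_congr rfl fun e he => ?_
  obtain rfl := (h.mem_toFinset.1 he).1
  rw [← mul_assoc, vtx_mul_edg]

theorem gap_mul_vtx {H : Set V} {v : V} (h : (G.outAvoiding H v).Finite) :
    gap K G H v * vtx K G v = gap K G H v := by
  rw [gap_eq_sub_sum h, sub_mul, vtx_mul_self, Finset.sum_mul]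
  congr 1
  refine Finset.sum_congr rfl fun e he => ?_
  obtain rfl := (h.mem_toFinset.1 he).1
  rw [mul_assoc, gho_mul_vtx]

theorem gap_mul_edg {H : Set V} {v : V} (h : (G.outAvoiding H v).Finite) {e : E}
    (he : e ∈ G.outAvoiding H v) : gap K G H v * edg K G e = 0 := by
  obtain rfl := he.1
  rw [gap_eq_sub_sum h, sub_mul, vtx_mul_edg, Finset.sum_mul,
    Finset.sum_eq_single_of_mem e (h.mem_toFinset.2 he), mul_assoc, gho_mul_edg_self,
    edg_mul_vtx, sub_self]
  intro f _ hf
  rw [mul_assoc, gho_mul_edg_ne hf, mul_zero]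

theorem gho_mul_gap {H : Set V} {v : V} (h : (G.outAvoiding H v).Finite) {e : E}
    (he : e ∈ G.outAvoiding H v) : gho K G e * gap K G H v = 0 := by
  obtain rfl := he.1
  rw [gap_eq_sub_sum h, mul_sub, gho_mul_vtx, Finset.mul_sum,
    Finset.sum_eq_single_of_mem e (h.mem_toFinset.2 he), ← mul_assoc, gho_mul_edg_self,
    vtx_mul_gho, sub_self]
  intro f _ hf
  rw [← mul_assoc, gho_mul_edg_ne hf.symm, zero_mul]

theorem gap_mul_self {H : Set V} {v : V} (h : (G.outAvoiding H v).Finite) :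
    gap K G H v * gap K G H v = gap K G H v := by
  conv_lhs => rw [gap_eq_sub_sum h, sub_mul, ← gap_eq_sub_sum h, vtx_mul_gap h, Finset.sum_mul]
  rw [Finset.sum_eq_zero, sub_zero]
  intro e he
  rw [mul_assoc, gho_mul_gap h (h.mem_toFinset.1 he), mul_zero]

/-- The vertices that belong to an ideal. -/
def vertexSet (I : TwoSidedIdeal (LPA K G)) : Set V := {v | vtx K G v ∈ I}

theorem edg_mem {I : TwoSidedIdeal (LPA K G)} {e : E} (h : G.rng e ∈ vertexSet I) :
    edg K G e ∈ I := by
  rw [← edg_mul_vtx]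
  exact I.mul_mem_left _ _ h

theorem gho_mem {I : TwoSidedIdeal (LPA K G)} {e : E} (h : G.rng e ∈ vertexSet I) :
    gho K G e ∈ I := by
  rw [← vtx_mul_gho]
  exact I.mul_mem_right _ _ h

/-- Edges into H lie in `I`, and v^H annihilates the remaining edges at `v` outright; modulo `I`,
v^H behaves like a sink. -/
theorem gap_mul_edg_mem {I : TwoSidedIdeal (LPA K G)} {v : V}
    (h : (G.outAvoiding (vertexSet I) v).Finite) {e : E} (he : G.src e = v) :
    gap K G (vertexSet I) v * edg K G e ∈ I := by
  by_cases hr : G.rng e ∈ vertexSet I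
  · exact I.mul_mem_left _ _ (edg_mem hr)
  · rw [gap_mul_edg h ⟨he, hr⟩]
    exact I.zero_mem

theorem gap_mul_realPath_mem {I : TwoSidedIdeal (LPA K G)} {v w : V}
    (h : (G.outAvoiding (vertexSet I) v).Finite) {γ : List E} (hγ : γ ≠ [])
    (hp : G.IsPath v γ w) : gap K G (vertexSet I) v * realPath K G v γ ∈ I := by
  obtain ⟨e, γ, rfl⟩ := List.exists_cons_of_ne_nil hγ
  obtain rfl := hp.1
  rw [realPath, vtx_mul_edg, ← mul_assoc]
  exact I.mul_mem_right _ _ (gap_mul_edg_mem h rfl)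

theorem gap_mul_mem_of_closedPathsAt {I : TwoSidedIdeal (LPA K G)} {v : V}
    (h : (G.outAvoiding (vertexSet I) v).Finite) {r : LPA K G} (hr : r ∈ closedPathsAt K G v) :
    gap K G (vertexSet I) v * r ∈ I := by
  induction hr using Submodule.span_induction with
  | zero => simp
  | smul k x _ hx => rw [mul_smul_comm]; exact smul_mem_ideal I k hx
  | add x y _ _ hx hy => rw [mul_add]; exact I.add_mem hx hy
  | mem x hx =>
    obtain ⟨γ, hγ, rfl⟩ := hx
    exact gap_mul_realPath_mem h hγ.1 hγ.2

/-! ### The reduction theorem -/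

/-- Modulo `I`, the element `x` can be multiplied into a nonzero vertex or a nonzero `v^H`. -/
def Compressible (I : TwoSidedIdeal (LPA K G)) (x : LPA K G) : Prop :=
  ∃ s t g, s * x * t - g ∈ I ∧ g ∉ I ∧
    ∃ v, g = vtx K G v ∨ v ∈ G.BH (vertexSet I) ∧ g = gap K G (vertexSet I) v

theorem Compressible.of_mul {I : TwoSidedIdeal (LPA K G)} {x : LPA K G} (y z : LPA K G)
    (h : Compressible I (y * x * z)) : Compressible I x := by
  obtain ⟨s, t, g, h, hg⟩ := h
  exact ⟨s * y, z * t, g, by simpa only [mul_assoc] using h, hg⟩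

theorem Compressible.of_mul_right {I : TwoSidedIdeal (LPA K G)} {x : LPA K G} (z : LPA K G)
    (h : Compressible I (x * z)) : Compressible I x := by
  obtain ⟨s, t, g, h, hg⟩ := h
  exact ⟨s, z * t, g, by simpa only [mul_assoc] using h, hg⟩

theorem Compressible.of_sub_mem {I : TwoSidedIdeal (LPA K G)} {x y : LPA K G}
    (h : Compressible I x) (hxy : y - x ∈ I) : Compressible I y := by
  obtain ⟨s, t, g, h, hg⟩ := h
  refine ⟨s, t, g, ?_, hg⟩
  have := I.add_mem (I.mul_mem_right _ t (I.mul_mem_left s _ hxy)) h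
  rwa [mul_sub, sub_mul, sub_add_sub_cancel] at this

theorem compressible_smul_vtx {I : TwoSidedIdeal (LPA K G)} {v : V} (hv : vtx K G v ∉ I) {k : K}
    (hk : k ≠ 0) : Compressible I (k • vtx K G v) := by
  refine ⟨k⁻¹ • vtx K G v, vtx K G v, vtx K G v, ?_, hv, v, Or.inl rfl⟩
  rw [smul_mul_smul_comm, inv_mul_cancel₀ hk, one_smul, vtx_mul_self, vtx_mul_self, sub_self]
  exact I.zero_mem

theorem compressible_smul_gap {I : TwoSidedIdeal (LPA K G)} {v : V}
    (hv : v ∈ G.BH (vertexSet I)) (hg : gap K G (vertexSet I) v ∉ I) {k : K}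
    (hk : k ≠ 0) : Compressible I (k • gap K G (vertexSet I) v) := by
  have h := gap_mul_self (K := K) hv.2.2.2
  refine ⟨k⁻¹ • gap K G (vertexSet I) v, gap K G (vertexSet I) v, gap K G (vertexSet I) v, ?_,
    hg, v, Or.inr ⟨hv, rfl⟩⟩
  rw [smul_mul_smul_comm, inv_mul_cancel₀ hk, one_smul, h, h, sub_self]
  exact I.zero_mem

/-- The compression to a multiple of `v` is an exact identity; `I` enters only through y ≠ 0 and v ∉
I. -/
theorem compressible_of_realPathsTo (hK : G.ConditionK) {I : TwoSidedIdeal (LPA K G)} {v : V}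
    {y : LPA K G} (hy : y ∈ realPathsTo K G v) (hyI : y ∉ I) : Compressible I y := by
  have hv : vtx K G v ∉ I := fun h => hyI <| by
    rw [← mul_vtx_of_mem_realPathsTo hy]
    exact I.mul_mem_left _ _ h
  obtain ⟨s, k, hk, r, hr, h⟩ := exists_mul_eq_smul_vtx_add hy
    fun h => hyI (h ▸ I.zero_mem)
  obtain ⟨δ, hδ, hδr⟩ := exists_conj_eq_zero hK hr [] rfl
  refine Compressible.of_mul (ghostPath K G v δ * s) (realPath K G v δ) ?_
  rw [mul_assoc (ghostPath K G v δ), h, mul_add, add_mul, List.nil_append] at *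
  rw [hδr, add_zero, mul_smul_comm, smul_mul_assoc, ghostPath_mul_vtx, ghostPath_mul_realPath hδ]
  exact compressible_smul_vtx hv hk

/-- If `y` is a combination of real paths ending at `v` and `y e ∈ I` for almost all edges `e`
emitted by `v`, then `v` emits finitely many edges outside `I`. -/
theorem finite_outAvoiding_of_mul_edg_mem {I : TwoSidedIdeal (LPA K G)} {v : V}
    {y : LPA K G} (hy : y ∈ realPathsTo K G v) (hyI : y ∉ I) (F : Finset E)
    (hF : ∀ e ∉ F, G.src e = v → y * edg K G e ∈ I) :
    (G.outAvoiding (vertexSet I) v).Finite := by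
  obtain ⟨s, k, hk, r, hr, h⟩ := exists_mul_eq_smul_vtx_add hy
    fun h => hyI (h ▸ I.zero_mem)
  -- If `e` is outside `F` and e*r = 0, then e*(sy)e = k·r(e) lies in `I`, so the range of `e` is in
  -- the vertex set.
  refine (F.finite_toSet.union (finite_gho_mul_ne_zero hr)).subset fun e he => ?_
  by_contra hne
  simp only [Set.mem_union, SetLike.mem_coe, Set.mem_ofPred_eq, not_or, not_not] at hne
  obtain ⟨rfl, he⟩ := he
  have h1 : gho K G e * (s * y) * edg K G e ∈ I := by
    rw [← mul_assoc, mul_assoc]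
    exact I.mul_mem_left _ _ (hF e hne.1 rfl)
  rw [h, mul_add, hne.2, add_zero, mul_smul_comm, gho_mul_vtx, smul_mul_assoc,
    gho_mul_edg_self] at h1
  refine he ?_
  have h2 := smul_mem_ideal I k⁻¹ h1
  rwa [smul_smul, inv_mul_cancel₀ hk, one_smul] at h2

/-- Condition (K) is not needed here: the leftover closed paths are killed modulo `I` by v^H on the
left. -/
theorem compressible_mul_gap {I : TwoSidedIdeal (LPA K G)} {v : V}
    (hv : v ∈ G.BH (vertexSet I)) {y : LPA K G} (hy : y ∈ realPathsTo K G v)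
    (hyI : y * gap K G (vertexSet I) v ∉ I) :
    Compressible I (y * gap K G (vertexSet I) v) := by
  set g := gap K G (vertexSet I) v with hg
  obtain ⟨s, k, hk, r, hr, h⟩ := exists_mul_eq_smul_vtx_add hy
    (by rintro rfl; exact hyI (by simp))
  refine Compressible.of_mul (g * s) g (Compressible.of_sub_mem (compressible_smul_gap hv
    (fun hgI => hyI (I.mul_mem_left _ _ hgI)) hk) ?_)
  have h1 : g * s * (y * g) * g = k • g + g * r * g := by
    have : g * s * (y * g) * g = g * (s * y) * (g * g) := by simp only [mul_assoc]
    rw [this, gap_mul_self hv.2.2.2, h, mul_add, add_mul, mul_smul_comm, gap_mul_vtx hv.2.2.2,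
      smul_mul_assoc, gap_mul_self hv.2.2.2]
  rw [h1, add_sub_cancel_left]
  exact I.mul_mem_right _ _ (gap_mul_mem_of_closedPathsAt hv.2.2.2 hr)

/-- Either some edge lowers the ghost degree without entering `I`, or `x` is congruent to y v^H,
where y is its part of ghost degree zero. -/
theorem compressible_of_ghostDegreeLE (hK : G.ConditionK) {I : TwoSidedIdeal (LPA K G)} (N : ℕ) :
    ∀ {v : V} {x : LPA K G}, x ∈ ghostDegreeLE K G N v → x ∉ I → Compressible I x := by
  classical
  induction N with
  | zero => exact fun hx hxI => compressible_of_realPathsTo hK (ghostDegreeLE_zero _ hx) hxI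
  | succ N ih =>
    intro v x hx hxI
    obtain ⟨y, hy, z, hz, hzv, hxz⟩ := exists_eq_add_sum hx
    have hxe : ∀ e, G.src e = v → x * edg K G e = y * edg K G e + z e := by
      intro e he
      rw [hxz, add_mul, Finsupp.sum, Finset.sum_mul, Finset.sum_eq_single e]
      · rw [mul_assoc, gho_mul_edg_self, mul_vtx_of_mem_ghostDegreeLE (hz e)]
      · intro f _ hf
        rw [mul_assoc, gho_mul_edg_ne hf, mul_zero]
      · intro h
        rw [Finsupp.notMem_support_iff.1 h, zero_mul, zero_mul]
    by_cases hex : ∃ e, G.src e = v ∧ x * edg K G e ∉ I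
    · obtain ⟨e, rfl, he⟩ := hex
      refine Compressible.of_mul_right _ (ih (v := G.rng e) ?_ he)
      rw [hxe e rfl]
      exact add_mem (realPathsTo_le _ _ (mul_edg_mem_realPathsTo hy)) (hz e)
    push Not at hex
    have hzI : ∀ e, G.src e = v → y * edg K G e + z e ∈ I := fun e he => hxe e he ▸ hex e he
    have hyI : y ∉ I := by
      intro hyI
      refine hxI (hxz ▸ I.add_mem hyI (sum_mem fun e _ => ?_))
      by_cases he : G.src e = v
      · refine I.mul_mem_right _ _ ?_
        simpa using I.sub_mem (hzI e he) (I.mul_mem_right _ (edg K G e) hyI)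
      · simp only [hzv e he, zero_mul]
        exact I.zero_mem
    have hfin : (G.outAvoiding (vertexSet I) v).Finite := by
      refine finite_outAvoiding_of_mul_edg_mem hy hyI z.support fun e he hev => ?_
      simpa [Finsupp.notMem_support_iff.1 he] using hzI e hev
    set g := gap K G (vertexSet I) v with hg
    -- For edges at `v`, z_e ≡ −ye modulo `I`, and e* ∈ I when r(e) ∈ H. So x ≡ y − Σ y e e* over
    -- the edges avoiding H, which is y v^H.
    have hxg : x - y * g ∈ I := by
      have hsum : z.sum (fun e t => t * gho K G e) =
          ∑ e ∈ z.support ∪ hfin.toFinset, z e * gho K G e :=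
        Finset.sum_subset Finset.subset_union_left fun e _ he => by
          simp only [Finsupp.notMem_support_iff.1 he, zero_mul]
      have key : x - y * g = ∑ e ∈ z.support ∪ hfin.toFinset,
          (if e ∈ hfin.toFinset then (y * edg K G e + z e) * gho K G e
            else z e * gho K G e) := by
        rw [hxz, hsum, hg, gap_eq_sub_sum hfin, mul_sub, mul_vtx_of_mem_realPathsTo hy,
          Finset.mul_sum]
        have : ∑ e ∈ hfin.toFinset, y * (edg K G e * gho K G e) =
            ∑ e ∈ z.support ∪ hfin.toFinset,
              (if e ∈ hfin.toFinset then y * (edg K G e * gho K G e) else 0) := by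
          rw [Finset.sum_ite_mem, Finset.union_inter_cancel_right]
        rw [this, add_sub_sub_cancel, ← Finset.sum_add_distrib]
        refine Finset.sum_congr rfl fun e _ => ?_
        split_ifs
        · rw [add_mul, mul_assoc, add_comm]
        · rw [add_zero]
      rw [key]
      refine sum_mem fun e _ => ?_
      split_ifs with he
      · exact I.mul_mem_right _ _ (hzI e (hfin.mem_toFinset.1 he).1)
      · by_cases hev : G.src e = v
        · refine I.mul_mem_left _ _ (gho_mem ?_)
          by_contra hr
          exact he (hfin.mem_toFinset.2 ⟨hev, hr⟩)
        · rw [hzv e hev, zero_mul]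
          exact I.zero_mem
    have hygI : y * g ∉ I := fun h => hxI (by simpa using I.add_mem hxg h)
    -- With no edge avoiding H, v^H is `v` itself and `v` is not in B_H, so the case of real paths
    -- applies.
    by_cases hne : (G.outAvoiding (vertexSet I) v).Nonempty
    swap
    · refine Compressible.of_sub_mem (compressible_of_realPathsTo hK hy hyI) ?_
      have : g = vtx K G v := by
        rw [hg, gap_eq_sub_sum hfin, Finset.sum_eq_zero, sub_zero]
        exact fun e he => absurd ⟨e, hfin.mem_toFinset.1 he⟩ hne
      rwa [this, mul_vtx_of_mem_realPathsTo hy] at hxg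
    refine Compressible.of_sub_mem (compressible_mul_gap ⟨?_, ?_, hne, hfin⟩ hy hygI) hxg
    · intro hv
      refine hxI ?_
      rw [← mul_vtx_of_mem_ghostDegreeLE hx]
      exact I.mul_mem_left _ _ hv
    -- If `v` emitted finitely many edges, x = Σ x f f* would lie in `I`.
    · intro hout
      refine hxI ?_
      obtain ⟨e, he, -⟩ := hne
      rw [← mul_vtx_of_mem_ghostDegreeLE hx, ← (isLeavittFamily K G).sum_eq v hout ⟨e, he⟩,
        Finset.mul_sum]
      refine sum_mem fun f hf => ?_
      rw [← mul_assoc]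
      exact I.mul_mem_right _ _ (hex f (hout.mem_toFinset.1 hf))

/-- The reduction theorem: under Condition (K), every element outside an ideal `I` can be
compressed, modulo `I`, to a vertex or to an element `v^H` outside `I`. -/
theorem ConditionK.compressible (hK : G.ConditionK) {I : TwoSidedIdeal (LPA K G)} {x : LPA K G}
    (hx : x ∉ I) : Compressible I x := by
  obtain ⟨v, hv⟩ := exists_mul_vtx_notMem hx
  obtain ⟨N, hN⟩ := exists_mul_vtx_mem_ghostDegreeLE x v
  exact (compressible_of_ghostDegreeLE hK N hN hv).of_mul_right

end Compression

/-! ### Ideals are determined by their vertices and elements v^H -/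

section Ideals

variable {K : Type u₃} [Field K] {V : Type u₁} {E : Type u₂} {G : DirGraph V E}

theorem mem_vertexSet_of_reaches {I : TwoSidedIdeal (LPA K G)} {v w : V} (h : G.Reaches v w)
    (hv : v ∈ vertexSet I) : w ∈ vertexSet I := by
  obtain ⟨α, hα⟩ := h
  change vtx K G w ∈ I
  rw [← ghostPath_mul_realPath hα, ← vtx_mul_realPath]
  exact I.mul_mem_left _ _ (I.mul_mem_right _ _ hv)

theorem exists_rng_notMem_vertexSet {I : TwoSidedIdeal (LPA K G)} {v : V}
    (hv : v ∉ vertexSet I) (hne : (G.out v).Nonempty) (hfin : (G.out v).Finite) :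
    ∃ e, G.src e = v ∧ G.rng e ∉ vertexSet I := by
  by_contra! h
  refine hv ?_
  change vtx K G v ∈ I
  rw [← (isLeavittFamily K G).sum_eq v hfin hne]
  exact sum_mem fun e he => I.mul_mem_right _ _ (edg_mem (h e (hfin.mem_toFinset.1 he)))

theorem eq_top_of_vertexSet_eq_univ {I : TwoSidedIdeal (LPA K G)}
    (h : ∀ v, v ∈ vertexSet I) : I = ⊤ := by
  refine top_unique fun x _ => ?_
  by_contra hx
  obtain ⟨v, hv⟩ := exists_mul_vtx_notMem hx
  exact hv (I.mul_mem_left _ _ (h v))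

/-- The vertices `v ∈ B_H` with `v^H ∈ I`, where `H` is the set of vertices in `I`. -/
def gapSet (I : TwoSidedIdeal (LPA K G)) : Set V :=
  {v | v ∈ G.BH (vertexSet I) ∧ gap K G (vertexSet I) v ∈ I}

/-- Under Condition (K), every ideal is determined by its vertices and its elements `v^H`. -/
theorem ConditionK.eq_idealHS (hK : G.ConditionK) (P : TwoSidedIdeal (LPA K G)) :
    P = idealHS K G (vertexSet P) (gapSet P) := by
  set I := idealHS K G (vertexSet P) (gapSet P) with hI
  have hIP : I ≤ P := by
    rw [hI, idealHS, TwoSidedIdeal.span_le]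
    rintro _ (⟨v, hv, rfl⟩ | ⟨v, hv, rfl⟩)
    exacts [hv, hv.2]
  have hH : vertexSet I = vertexSet P := by
    refine Set.Subset.antisymm (fun v hv => hIP hv) fun v hv => ?_
    exact TwoSidedIdeal.subset_span (Or.inl ⟨v, hv, rfl⟩)
  refine le_antisymm (fun x hx => ?_) hIP
  -- An element of `P` outside `I` compresses modulo `I` to some `g` in `P` but not in `I`; yet such
  -- a `g` is one of the generators of `I`.
  by_contra hxI
  obtain ⟨s, t, g, h, hg, v, hv⟩ := hK.compressible hxI
  have hgP : g ∈ P := by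
    have := P.sub_mem (P.mul_mem_right _ t (P.mul_mem_left s _ hx)) (hIP h)
    rwa [sub_sub_cancel] at this
  rw [hH] at hv
  rcases hv with rfl | ⟨hv, rfl⟩
  · exact hg (hH.ge hgP)
  · exact hg (TwoSidedIdeal.subset_span (Or.inr ⟨v, ⟨hv, hgP⟩, rfl⟩))

end Ideals

/-! ### A representation detecting H and S -/

section Representation

/-- A bijection between `ℕ` and `T × ℕ`, for a nonempty countable set `T`, as a pair of total
functions. -/
theorem exists_nat_prod_coding {X : Type*} (T : Set X) (hT : T.Countable)
    (hne : T.Nonempty) : ∃ (dec : ℕ → X × ℕ) (enc : X → ℕ → ℕ), (∀ m, (dec m).1 ∈ T) ∧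
      (∀ o ∈ T, ∀ n, dec (enc o n) = (o, n)) ∧ ∀ m, enc (dec m).1 (dec m).2 = m := by
  classical
  have := hT.to_subtype
  have := hne.to_subtype
  obtain ⟨φ⟩ : Nonempty (T × ℕ ≃ ℕ) := nonempty_equiv_of_countable
  refine ⟨fun m => ((φ.symm m).1, (φ.symm m).2),
    fun o n => if h : o ∈ T then φ (⟨o, h⟩, n) else 0, fun m => (φ.symm m).1.2,
    fun o ho n => by simp [ho], fun m => by simp⟩

variable (K : Type u₃) [Field K] {V : Type u₁} {E : Type u₂} [Countable E] (G : DirGraph V E)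

/-- For `H` hereditary and saturated and `S ⊆ B_H`, there is a representation whose kernel contains
exactly the vertices in `H`, and the elements `v^H` with `v ∈ S` but with no other `v ∈ B_H`. -/
theorem exists_representation (H S : Set V) (hher : ∀ e, G.src e ∈ H → G.rng e ∈ H)
    (hsat : ∀ v ∉ H, (G.out v).Nonempty → (G.out v).Finite → ∃ e, G.src e = v ∧ G.rng e ∉ H)
    (hS : S ⊆ G.BH H) : ∃ φ : LPA K G →ₙₐ[K] Module.End K (V → ℕ → K),
      (∀ v, φ (vtx K G v) = 0 ↔ v ∈ H) ∧ ∀ v ∈ G.BH H, φ (gap K G H v) = 0 ↔ v ∈ S := by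
  classical
  -- The fibre ℕ over `v` is cut into copies of ℕ indexed by `T v`: one block per edge avoiding `H`,
  -- plus a spare block `none` on which v − Σ ee* survives. The spare is withheld where that
  -- difference must vanish: at finite nonzero emitters and on `S`.
  let T : V → Set (Option E) := fun v => {o | (∃ e ∈ G.outAvoiding H v, o = some e) ∨
    o = none ∧ v ∉ S ∧ ¬ ((G.out v).Nonempty ∧ (G.out v).Finite)}
  have hT : ∀ v, ∃ (dec : ℕ → Option E × ℕ) (enc : Option E → ℕ → ℕ), v ∉ H →
      (∀ m, (dec m).1 ∈ T v) ∧ (∀ o ∈ T v, ∀ n, dec (enc o n) = (o, n)) ∧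
        ∀ m, enc (dec m).1 (dec m).2 = m := by
    intro v
    by_cases hv : v ∈ H
    -- Arbitrary values: the operators below never use the coding over `H`.
    · exact ⟨fun _ => (none, 0), fun _ _ => 0, fun h => absurd hv h⟩
    have hne : (T v).Nonempty := by
      by_cases hr : (G.out v).Nonempty ∧ (G.out v).Finite
      · obtain ⟨e, he⟩ := hsat v hv hr.1 hr.2
        exact ⟨some e, Or.inl ⟨e, he, rfl⟩⟩
      by_cases hvS : v ∈ S
      · obtain ⟨e, he⟩ := (hS hvS).2.2.1
        exact ⟨some e, Or.inl ⟨e, he, rfl⟩⟩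
      · exact ⟨none, Or.inr ⟨rfl, hvS, hr⟩⟩
    obtain ⟨dec, enc, h⟩ := exists_nat_prod_coding (T v) (Set.to_countable _) hne
    exact ⟨dec, enc, fun _ => h⟩
  choose dec enc hcode using hT
  have hsome : ∀ e, G.rng e ∉ H → ∀ n, dec (G.src e) (enc (G.src e) (some e) n) = (some e, n) :=
    fun e he => (hcode _ fun h => he (hher e h)).2.1 _ (Or.inl ⟨e, ⟨rfl, he⟩, rfl⟩)
  -- Off `H`, `a v` restricts to the fibre over `v`, `b e` carries the fibre over r(e) to the block
  -- `some e` over s(e), and `b' e` reads that block back.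
  let a : V → Module.End K (V → ℕ → K) := fun v =>
    { toFun := fun f w m => if w = v ∧ v ∉ H then f w m else 0
      map_add' := fun f g => by
        ext w m
        simp only [Pi.add_apply]
        split_ifs <;> simp
      map_smul' := fun k f => by ext w m; simp }
  let b : E → Module.End K (V → ℕ → K) := fun e =>
    { toFun := fun f w m => if w = G.src e ∧ G.rng e ∉ H ∧ (dec w m).1 = some e then
        f (G.rng e) (dec w m).2 else 0
      map_add' := fun f g => by
        ext w m
        simp only [Pi.add_apply]
        split_ifs <;> simp
      map_smul' := fun k f => by ext w m; simp }
  let b' : E → Module.End K (V → ℕ → K) := fun e =>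
    { toFun := fun f w m => if w = G.rng e ∧ G.rng e ∉ H then
        f (G.src e) (enc (G.src e) (some e) m) else 0
      map_add' := fun f g => by
        ext w m
        simp only [Pi.add_apply]
        split_ifs <;> simp
      map_smul' := fun k f => by ext w m; simp }
  have ha : ∀ v f w m, a v f w m = if w = v ∧ v ∉ H then f w m else 0 := fun _ _ _ _ => rfl
  have hb : ∀ e f w m, b e f w m = if w = G.src e ∧ G.rng e ∉ H ∧ (dec w m).1 = some e then
        f (G.rng e) (dec w m).2 else 0 := fun _ _ _ _ => rfl
  have hb' : ∀ e f w m, b' e f w m = if w = G.rng e ∧ G.rng e ∉ H then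
        f (G.src e) (enc (G.src e) (some e) m) else 0 := fun _ _ _ _ => rfl
  have hsum : ∀ v (F : Finset E), (∀ e ∈ F, G.src e = v) → ∀ f w m,
      (∑ e ∈ F, b e * b' e) f w m =
        if w = v ∧ ∃ e ∈ F, G.rng e ∉ H ∧ (dec w m).1 = some e then f w m else 0 := by
    intro v F hF f w m
    rw [LinearMap.sum_apply, Finset.sum_apply, Finset.sum_apply]
    have hterm : ∀ e ∈ F, (b e * b' e) f w m =
        if w = v ∧ G.rng e ∉ H ∧ (dec w m).1 = some e then f w m else 0 := by
      intro e he
      rw [Module.End.mul_apply, hb, hF e he]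
      split_ifs with h
      · obtain ⟨rfl, hr, hd⟩ := h
        rw [hb', if_pos ⟨rfl, hr⟩, hF e he, ← hd,
          (hcode w fun h => hr (hher e (by rwa [hF e he]))).2.2]
      · rfl
    rw [Finset.sum_congr rfl hterm]
    split_ifs with h
    · obtain ⟨rfl, e, he, hr, hd⟩ := h
      rw [Finset.sum_eq_single_of_mem e he, if_pos ⟨rfl, hr, hd⟩]
      intro e' _ hne
      refine if_neg fun h => hne ?_
      simpa [hd] using h.2.2.symm
    · exact Finset.sum_eq_zero fun e he => if_neg fun h' => h ⟨h'.1, e, he, h'.2⟩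
  have hfam : G.IsLeavittFamily a b b' :=
    { idem := fun v => by
        ext f w m
        simp only [Module.End.mul_apply, ha]
        split_ifs <;> rfl
      orth := fun v w hvw => by
        ext f u m
        simp only [Module.End.mul_apply, ha, LinearMap.zero_apply, Pi.zero_apply]
        split_ifs with h h'
        · exact absurd (h.1.symm.trans h'.1) hvw
        all_goals rfl
      src_mul := fun e => by
        ext f w m
        simp only [Module.End.mul_apply, ha, hb]
        split_ifs with h h' h'
        · rfl
        · rfl
        · exact absurd ⟨h'.1, fun h => h'.2.1 (hher e h)⟩ h
        · rfl
      mul_rng := fun e => by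
        ext f w m
        simp only [Module.End.mul_apply, ha, hb]
        split_ifs with h h'
        · rfl
        · exact absurd ⟨trivial, h.2.1⟩ h'
        · rfl
      rng_mul := fun e => by
        ext f w m
        simp only [Module.End.mul_apply, ha, hb']
        split_ifs <;> rfl
      mul_src := fun e => by
        ext f w m
        simp only [Module.End.mul_apply, ha, hb']
        split_ifs with h h'
        · rfl
        · exact absurd ⟨trivial, fun h' => h.2 (hher e h')⟩ h'
        · rfl
      ghost_mul_self := fun e => by
        ext f w m
        simp only [Module.End.mul_apply, ha, hb, hb']
        by_cases h : w = G.rng e ∧ G.rng e ∉ H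
        · obtain ⟨rfl, h⟩ := h
          simp [h, hsome e h]
        · rw [if_neg h, if_neg h]
      ghost_mul_ne := fun e e' hne => by
        ext f w m
        simp only [Module.End.mul_apply, hb, hb', LinearMap.zero_apply, Pi.zero_apply]
        split_ifs with h h'
        · rw [hsome e h.2] at h'
          exact absurd (Option.some.inj h'.2.2) hne
        all_goals rfl
      sum_eq := fun v hfin hne => by
        ext f w m
        rw [hsum v _ (fun e he => hfin.mem_toFinset.1 he), ha]
        refine if_congr (and_congr_right ?_) rfl rfl
        rintro rfl
        constructor
        · rintro ⟨e, he, hr, -⟩ hw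
          have hs : G.src e = w := hfin.mem_toFinset.1 he
          exact hr (hher e (hs ▸ hw))
        · intro hw
          rcases (hcode w hw).1 m with ⟨e, he, hd⟩ | ⟨-, -, h⟩
          · exact ⟨e, hfin.mem_toFinset.2 he.1, he.2, hd⟩
          · exact absurd ⟨hne, hfin⟩ h }
  obtain ⟨φ, ⟨hφ, hφe, hφg⟩, -⟩ := existsUnique_hom K G hfam
  refine ⟨φ, fun v => ?_, fun v hv => ?_⟩
  · rw [hφ]
    constructor
    · intro h
      by_contra hv
      have := congrFun (congrFun (LinearMap.congr_fun h fun _ _ => 1) v) 0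
      simp [ha, hv] at this
    · intro hv
      ext f w m
      simp [ha, hv]
  -- v^H acts as the projection onto the spare block, hence as 0 exactly when there is none.
  · have hval : ∀ f w m, φ (gap K G H v) f w m =
        if w = v ∧ (dec w m).1 = none then f w m else 0 := by
      intro f w m
      rw [gap_eq_sub_sum hv.2.2.2, map_sub, map_sum, hφ]
      simp only [map_mul, hφe, hφg]
      rw [LinearMap.sub_apply, Pi.sub_apply, Pi.sub_apply, ha,
        hsum v _ (fun e he => (hv.2.2.2.mem_toFinset.1 he).1)]
      by_cases hw : w = v
      · subst hw
        rcases (hcode w hv.1).1 m with ⟨e, he, hd⟩ | ⟨hd, -⟩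
        · have : ∃ e ∈ hv.2.2.2.toFinset, G.rng e ∉ H ∧ (dec w m).1 = some e :=
            ⟨e, hv.2.2.2.mem_toFinset.2 he, he.2, hd⟩
          rw [if_pos ⟨rfl, hv.1⟩, if_pos ⟨rfl, this⟩, if_neg (by simp [hd]), sub_self]
        · rw [if_pos ⟨rfl, hv.1⟩, if_neg (by simp [hd]), if_pos ⟨rfl, hd⟩, sub_zero]
      · simp [hw]
    constructor
    · intro h
      by_contra hvS
      have hnone := (hcode v hv.1).2.1 none (Or.inr ⟨rfl, hvS, fun h => hv.2.1 h.2⟩) 0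
      have := congrFun (congrFun (LinearMap.congr_fun h fun _ _ => 1) v) (enc v none 0)
      rw [hval, hnone] at this
      simp at this
    · intro hvS
      ext f w m
      rw [hval]
      refine if_neg ?_
      rintro ⟨rfl, hd⟩
      rcases (hcode w hv.1).1 m with ⟨e, he, hd'⟩ | ⟨-, h, -⟩
      · simp [hd] at hd'
      · exact h hvS

end Representation

/-! ### The vertices and elements v^H of I(H,S) -/

section IdealHS

variable {K : Type u₃} [Field K] {V : Type u₁} {E : Type u₂} [Countable E] {G : DirGraph V E}
  {H S : Set V}

/-- For `H` hereditary and saturated and `S ⊆ B_H`, the ideal `I(H, S)` contains no vertices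
outside `H` and no elements `v^H` with `v ∈ B_H \ S`. -/
theorem idealHS_spec (hher : ∀ e, G.src e ∈ H → G.rng e ∈ H)
    (hsat : ∀ v ∉ H, (G.out v).Nonempty → (G.out v).Finite → ∃ e, G.src e = v ∧ G.rng e ∉ H)
    (hS : S ⊆ G.BH H) : vertexSet (idealHS K G H S) = H ∧
      ∀ v ∈ G.BH H, gap K G H v ∈ idealHS K G H S ↔ v ∈ S := by
  obtain ⟨φ, hφ, hφg⟩ := exists_representation K G H S hher hsat hS
  have hle : idealHS K G H S ≤ TwoSidedIdeal.ker φ := by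
    rw [idealHS, TwoSidedIdeal.span_le]
    rintro _ (⟨v, hv, rfl⟩ | ⟨v, hv, rfl⟩)
    · exact (TwoSidedIdeal.mem_ker φ).2 ((hφ v).2 hv)
    · exact (TwoSidedIdeal.mem_ker φ).2 ((hφg v (hS hv)).2 hv)
  refine ⟨Set.Subset.antisymm (fun v hv => ?_) fun v hv => ?_,
    fun v hv => ⟨fun h => ?_, fun h => ?_⟩⟩
  · exact (hφ v).1 ((TwoSidedIdeal.mem_ker φ).1 (hle hv))
  · exact TwoSidedIdeal.subset_span (Or.inl ⟨v, hv, rfl⟩)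
  · exact (hφg v hv).1 ((TwoSidedIdeal.mem_ker φ).1 (hle h))
  · exact TwoSidedIdeal.subset_span (Or.inr ⟨v, h, rfl⟩)

end IdealHS

/-! ### The sets Ω(X) -/

section Omega

variable {V : Type u₁} {E : Type u₂} {G : DirGraph V E}

theorem mem_Omega_iff {X : Set V} {w : V} : w ∈ G.Omega X ↔ ∀ x ∈ X, ¬ G.Reaches w x :=
  ⟨fun h => h.2, fun h => ⟨fun hw => h w hw (Reaches.refl w), h⟩⟩

theorem notMem_Omega_iff {X : Set V} {w : V} : w ∉ G.Omega X ↔ ∃ x ∈ X, G.Reaches w x := by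
  rw [mem_Omega_iff]
  push Not
  rfl

theorem Omega_hereditary (X : Set V) (e : E) (h : G.src e ∈ G.Omega X) : G.rng e ∈ G.Omega X :=
  mem_Omega_iff.2 fun x hx hr => mem_Omega_iff.1 h x hx ((reaches_of_edge e).trans hr)

/-- A vertex outside Ω(X) reaches `X`, and the first edge of a nontrivial path stays outside Ω(X);
so only the vertices of `X` itself need the hypothesis. -/
theorem Omega_saturated {X : Set V} (hX : ∀ v ∈ X, (G.out v).Nonempty → (G.out v).Finite →
    ∃ e, G.src e = v ∧ G.rng e ∉ G.Omega X) (v : V) (hv : v ∉ G.Omega X)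
    (hne : (G.out v).Nonempty) (hfin : (G.out v).Finite) :
    ∃ e, G.src e = v ∧ G.rng e ∉ G.Omega X := by
  obtain ⟨x, hx, α, hα⟩ := notMem_Omega_iff.1 hv
  cases α with
  | nil => cases hα; exact hX _ hx hne hfin
  | cons e α => exact ⟨e, hα.1, notMem_Omega_iff.2 ⟨x, hx, α, hα.2⟩⟩

theorem IsMaximalTail.notMem_Omega {M : Set V} (hM : G.IsMaximalTail M) {v : V} :
    v ∉ G.Omega M ↔ v ∈ M := by
  rw [notMem_Omega_iff]
  exact ⟨fun ⟨x, hx, h⟩ => hM.mt1 v x hx h, fun h => ⟨v, h, Reaches.refl v⟩⟩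

theorem BH_empty : G.BH ∅ = ∅ := by
  refine Set.eq_empty_of_forall_notMem fun v hv => hv.2.1 ?_
  simpa [outAvoiding, out] using hv.2.2.2

end Omega

/-! ### The listed ideals are prime -/

section Prime

variable {K : Type u₃} [Field K] {V : Type u₁} {E : Type u₂} {G : DirGraph V E}

/-- The condition ∃ j ∈ J, j − g ∈ I says that `g` lies in I + J. -/
theorem exists_sub_mul_mul_mem {I J : TwoSidedIdeal (LPA K G)} {g : LPA K G}
    (h : ∃ j ∈ J, j - g ∈ I) (s t : LPA K G) : ∃ j ∈ J, j - s * g * t ∈ I := by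
  obtain ⟨j, hj, hjg⟩ := h
  refine ⟨s * j * t, J.mul_mem_right _ _ (J.mul_mem_left _ _ hj), ?_⟩
  rw [← sub_mul, ← mul_sub]
  exact I.mul_mem_right _ _ (I.mul_mem_left _ _ hjg)

theorem exists_sub_vtx_mem_of_reaches {I J : TwoSidedIdeal (LPA K G)} {v w : V}
    (h : ∃ j ∈ J, j - vtx K G v ∈ I) (hvw : G.Reaches v w) : ∃ j ∈ J, j - vtx K G w ∈ I := by
  obtain ⟨α, hα⟩ := hvw
  simpa [ghostPath_mul_realPath hα] using
    exists_sub_mul_mul_mem h (ghostPath K G v α) (realPath K G v α)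

/-- An ideal is prime if any two ideals not contained in it contain, modulo it, a common
idempotent. -/
theorem isPrimeTwoSided_of_idempotent {P : TwoSidedIdeal (LPA K G)} (hP : P ≠ ⊤)
    (h : ∀ J₁ J₂ : TwoSidedIdeal (LPA K G), ¬ J₁ ≤ P → ¬ J₂ ≤ P → ∃ g, g * g = g ∧ g ∉ P ∧
      (∃ j ∈ J₁, j - g ∈ P) ∧ ∃ j ∈ J₂, j - g ∈ P) : IsPrimeTwoSided P := by
  refine ⟨hP, fun J₁ J₂ hJ => ?_⟩
  by_contra! hne
  obtain ⟨g, hg, hgP, ⟨j₁, hj₁, h₁⟩, j₂, hj₂, h₂⟩ := h J₁ J₂ hne.1 hne.2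
  refine hgP ?_
  -- Modulo `P`, the product j₁j₂ is g² = g.
  have := P.sub_mem (hJ j₁ hj₁ j₂ hj₂)
    (P.add_mem (P.mul_mem_right _ j₂ h₁) (P.mul_mem_left g _ h₂))
  rw [sub_mul, mul_sub, sub_add_sub_cancel, sub_sub_cancel, hg] at this
  exact this

theorem ConditionK.exists_sub_mem (hK : G.ConditionK) {I J : TwoSidedIdeal (LPA K G)}
    (hJ : ¬ J ≤ I) : ∃ g, (∃ j ∈ J, j - g ∈ I) ∧ g ∉ I ∧
      ∃ v, g = vtx K G v ∨ v ∈ G.BH (vertexSet I) ∧ g = gap K G (vertexSet I) v := by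
  obtain ⟨x, hx, hxI⟩ := Set.not_subset.1 hJ
  obtain ⟨s, t, g, h, hg⟩ := hK.compressible hxI
  exact ⟨g, ⟨_, J.mul_mem_right _ _ (J.mul_mem_left _ _ hx), h⟩, hg⟩

/-- All v^H with v ∈ B_H lie in the ideal, so compression always ends at a vertex of `M`; two such
vertices have a common lower bound in `M`. -/
theorem isPrimeTwoSided_of_isMaximalTail [Countable E] (hK : G.ConditionK) {M : Set V}
    (hM : G.IsMaximalTail M) : IsPrimeTwoSided (idealHS K G (G.Omega M) (G.BH (G.Omega M))) := by
  obtain ⟨hH, hg⟩ := idealHS_spec (K := K) (Omega_hereditary M) (Omega_saturated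
    fun v hv hne hfin => by
      simpa only [hM.notMem_Omega] using hM.mt2 v hv hne hfin) (subset_refl (G.BH (G.Omega M)))
  set I := idealHS K G (G.Omega M) (G.BH (G.Omega M))
  have hI : ∀ {v}, vtx K G v ∉ I ↔ v ∈ M := by
    intro v
    rw [← hM.notMem_Omega, ← hH]
    rfl
  refine isPrimeTwoSided_of_idempotent ?_ fun J₁ J₂ h₁ h₂ => ?_
  · obtain ⟨v, hv⟩ := hM.nonempty
    intro h
    exact hI.2 hv (h ▸ trivial)
  have hvtx : ∀ J : TwoSidedIdeal (LPA K G), ¬ J ≤ I → ∃ v ∈ M, ∃ j ∈ J, j - vtx K G v ∈ I := by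
    intro J hJ
    obtain ⟨g, hj, hgI, v, rfl | ⟨hv, rfl⟩⟩ := hK.exists_sub_mem hJ
    · exact ⟨v, hI.1 hgI, hj⟩
    · rw [hH] at hv hgI
      exact absurd ((hg v hv).2 hv) hgI
  obtain ⟨v₁, hv₁, hj₁⟩ := hvtx J₁ h₁
  obtain ⟨v₂, hv₂, hj₂⟩ := hvtx J₂ h₂
  obtain ⟨y, hy, r₁, r₂⟩ := hM.mt3 v₁ hv₁ v₂ hv₂
  exact ⟨vtx K G y, vtx_mul_self y, hI.2 hy, exists_sub_vtx_mem_of_reaches hj₁ r₁,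
    exists_sub_vtx_mem_of_reaches hj₂ r₂⟩

/-- Every vertex outside Ω(v) reaches `v`, and v^H is the only such element missing from the ideal;
so every ideal not below it contains v^H modulo it. -/
theorem isPrimeTwoSided_of_mem_BV [Countable E] (hK : G.ConditionK) {v : V} (hv : v ∈ G.BV) :
    IsPrimeTwoSided (idealHS K G (G.Omega {v}) (G.BH (G.Omega {v}) \ {v})) := by
  replace hv : v ∈ G.BH (G.Omega {v}) := hv
  obtain ⟨hH, hg⟩ := idealHS_spec (K := K) (Omega_hereditary {v}) (Omega_saturated
    fun w hw _ hfin => absurd (by rwa [Set.mem_singleton_iff.1 hw] at hfin) hv.2.1)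
    (Set.sdiff_subset : G.BH (G.Omega {v}) \ {v} ⊆ _)
  set I := idealHS K G (G.Omega {v}) (G.BH (G.Omega {v}) \ {v})
  have hgv : gap K G (G.Omega {v}) v ∉ I := fun h => ((hg v hv).1 h).2 rfl
  refine isPrimeTwoSided_of_idempotent (fun h => hgv (h ▸ trivial)) fun J₁ J₂ h₁ h₂ => ?_
  have hgap : ∀ J : TwoSidedIdeal (LPA K G), ¬ J ≤ I →
      ∃ j ∈ J, j - gap K G (G.Omega {v}) v ∈ I := by
    intro J hJ
    obtain ⟨g, hj, hgI, w, rfl | ⟨hw, rfl⟩⟩ := hK.exists_sub_mem hJ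
    · have hw : w ∉ G.Omega {v} := by
        rw [← hH]
        exact hgI
      obtain ⟨u, hu, hr⟩ := notMem_Omega_iff.1 hw
      rw [Set.mem_singleton_iff.1 hu] at hr
      simpa [vtx_mul_gap hv.2.2.2] using exists_sub_mul_mul_mem
        (exists_sub_vtx_mem_of_reaches hj hr) (vtx K G v) (gap K G (G.Omega {v}) v)
    · rw [hH] at hw hgI hj
      by_cases hwv : w = v
      · rwa [hwv] at hj
      · exact absurd ((hg w hw).2 ⟨hw, hwv⟩) hgI
  exact ⟨_, gap_mul_self hv.2.2.2, hgv, hgap J₁ h₁, hgap J₂ h₂⟩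

/-! ### Every prime ideal is listed -/

theorem exists_mul_mul_notMem {P : TwoSidedIdeal (LPA K G)} (hP : IsPrimeTwoSided P)
    {x y : LPA K G} (hx : x ∉ P) (hy : y ∉ P) : ∃ z, x * z * y ∉ P := by
  by_contra! h
  let J₁ : TwoSidedIdeal (LPA K G) := TwoSidedIdeal.mk' {a | ∀ z, a * z * y ∈ P}
    (fun z => by simp)
    (fun ha hb z => by rw [add_mul, add_mul]; exact P.add_mem (ha z) (hb z))
    (fun ha z => by rw [neg_mul, neg_mul]; exact P.neg_mem (ha z))
    (fun {r _} ha z => by rw [mul_assoc r, mul_assoc r]; exact P.mul_mem_left _ _ (ha z))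
    (fun {_ r} ha z => by rw [mul_assoc _ r]; exact ha (r * z))
  let J₂ : TwoSidedIdeal (LPA K G) := TwoSidedIdeal.mk' {b | ∀ a ∈ J₁, ∀ z, a * z * b ∈ P}
    (fun a _ z => by simp)
    (fun hb hc a ha z => by rw [mul_add]; exact P.add_mem (hb a ha z) (hc a ha z))
    (fun hb a ha z => by rw [mul_neg]; exact P.neg_mem (hb a ha z))
    (fun {r _} hb a ha z => by rw [← mul_assoc, mul_assoc a]; exact hb a ha (z * r))
    (fun {_ r} hb a ha z => by rw [← mul_assoc]; exact P.mul_mem_right _ _ (hb a ha z))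
  have h₁ : ∀ {a}, a ∈ J₁ ↔ ∀ z, a * z * y ∈ P := by simp [J₁, TwoSidedIdeal.mem_mk']
  have h₂ : ∀ {b}, b ∈ J₂ ↔ ∀ a ∈ J₁, ∀ z, a * z * b ∈ P := by simp [J₂, TwoSidedIdeal.mem_mk']
  have hmul : ∀ a ∈ J₁, ∀ b ∈ J₂, a * b ∈ P := fun a ha b hb => by
    -- A local unit serves as the middle factor that the definition of `J₂` requires.
    obtain ⟨F, hF⟩ := exists_mul_sum_vtx_eq a
    rw [← hF]
    exact h₂.1 hb a ha _
  rcases hP.2 J₁ J₂ hmul with hle | hle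
  · exact hx (hle (h₁.2 h))
  · exact hy (hle (h₂.2 fun a ha z => h₁.1 ha z))

/-- The middle factor of a product xzy ∉ P is a combination of monomials αβ*, and some monomial must
survive. -/
theorem exists_monomial_notMem {P : TwoSidedIdeal (LPA K G)} (hP : IsPrimeTwoSided P)
    {x y : LPA K G} (hx : x ∉ P) (hy : y ∉ P) : ∃ u α u' β w, G.IsPath u α w ∧
      G.IsPath u' β w ∧ x * realPath K G u α ∉ P ∧ ghostPath K G u' β * y ∉ P := by
  obtain ⟨z, hz⟩ := exists_mul_mul_notMem hP hx hy
  by_contra! h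
  have hmem := (span_monomials_eq_top (K := K) (G := G)).ge (Submodule.mem_top (x := z))
  refine hz ?_
  clear hz
  induction hmem using Submodule.span_induction with
  | zero => simp
  | add a b _ _ ha hb => rw [mul_add, add_mul]; exact P.add_mem ha hb
  | smul k a _ ha => rw [mul_smul_comm, smul_mul_assoc]; exact smul_mem_ideal P k ha
  | mem a ha =>
    obtain ⟨u, α, u', β, w, hα, hβ, rfl⟩ := ha
    rw [← mul_assoc, mul_assoc]
    by_cases hxα : x * realPath K G u α ∈ P
    · exact P.mul_mem_right _ _ hxα
    · exact P.mul_mem_left _ _ (h u α u' β w hα hβ hxα)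

theorem vtx_mul_realPath_ne {u v : V} (h : v ≠ u) (α : List E) :
    vtx K G v * realPath K G u α = 0 := by
  rw [← vtx_mul_realPath, ← mul_assoc, vtx_mul_ne h, zero_mul]

theorem ghostPath_mul_vtx_ne {u v : V} (h : u ≠ v) (α : List E) :
    ghostPath K G u α * vtx K G v = 0 := by
  rw [← ghostPath_mul_vtx, mul_assoc, vtx_mul_ne h, mul_zero]

theorem ghostPath_mul_gap_mem {I : TwoSidedIdeal (LPA K G)} {v : V}
    (h : (G.outAvoiding (vertexSet I) v).Finite) {u w : V} {β : List E} (hβ : β ≠ [])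
    (hp : G.IsPath u β w) : ghostPath K G u β * gap K G (vertexSet I) v ∈ I := by
  by_cases huv : u = v
  swap
  · rw [← vtx_mul_gap h, ← mul_assoc, ghostPath_mul_vtx_ne huv, zero_mul]
    exact I.zero_mem
  subst huv
  obtain ⟨e, β, rfl⟩ := List.exists_cons_of_ne_nil hβ
  rw [ghostPath, mul_assoc, vtx_mul_gap h, mul_assoc]
  refine I.mul_mem_left _ _ ?_
  by_cases hr : G.rng e ∈ vertexSet I
  · exact I.mul_mem_right _ _ (gho_mem hr)
  · rw [gho_mul_gap h ⟨hp.1, hr⟩]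
    exact I.zero_mem

/-- The vertices outside a prime ideal form a downward directed set. -/
theorem exists_reaches_of_isPrime {P : TwoSidedIdeal (LPA K G)} (hP : IsPrimeTwoSided P)
    {v w : V} (hv : v ∉ vertexSet P) (hw : w ∉ vertexSet P) :
    ∃ y ∉ vertexSet P, G.Reaches v y ∧ G.Reaches w y := by
  obtain ⟨u, α, u', β, y, hα, hβ, h₁, h₂⟩ := exists_monomial_notMem hP hv hw
  obtain rfl : v = u := by
    by_contra h
    exact h₁ (by rw [vtx_mul_realPath_ne h]; exact P.zero_mem)
  obtain rfl : u' = w := by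
    by_contra h
    exact h₂ (by rw [ghostPath_mul_vtx_ne h]; exact P.zero_mem)
  refine ⟨y, fun hy => h₁ ?_, ⟨α, hα⟩, β, hβ⟩
  rw [← realPath_mul_vtx hα]
  exact P.mul_mem_left _ _ (P.mul_mem_left _ _ hy)

/-- Modulo `P`, v^H kills every real path of positive length, so the real half of the monomial is
the vertex `v`. -/
theorem exists_ghostPath_of_gap_notMem {P : TwoSidedIdeal (LPA K G)} (hP : IsPrimeTwoSided P)
    {v : V} (hv : v ∈ G.BH (vertexSet P)) (hg : gap K G (vertexSet P) v ∉ P) {y : LPA K G}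
    (hy : y ∉ P) : ∃ u β, G.IsPath u β v ∧ ghostPath K G u β * y ∉ P := by
  obtain ⟨u, α, u', β, w, hα, hβ, h₁, h₂⟩ := exists_monomial_notMem hP hg hy
  obtain rfl : v = u := by
    by_contra h
    refine h₁ ?_
    rw [← gap_mul_vtx hv.2.2.2, mul_assoc, vtx_mul_realPath_ne h, mul_zero]
    exact P.zero_mem
  obtain rfl : α = [] := by
    by_contra h
    exact h₁ (gap_mul_realPath_mem hv.2.2.2 h hα)
  cases hα
  exact ⟨u', β, hβ, h₂⟩

theorem reaches_of_gap_notMem {P : TwoSidedIdeal (LPA K G)} (hP : IsPrimeTwoSided P)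
    {v : V} (hv : v ∈ G.BH (vertexSet P)) (hg : gap K G (vertexSet P) v ∉ P) {w : V}
    (hw : w ∉ vertexSet P) : G.Reaches w v := by
  obtain ⟨u, β, hβ, h⟩ := exists_ghostPath_of_gap_notMem hP hv hg hw
  obtain rfl : u = w := by
    by_contra hne
    exact h (by rw [ghostPath_mul_vtx_ne hne]; exact P.zero_mem)
  exact ⟨β, hβ⟩

/-- Between two such idempotents both halves of the monomial are trivial, so the two vertices agree.
-/
theorem eq_of_gap_notMem {P : TwoSidedIdeal (LPA K G)} (hP : IsPrimeTwoSided P)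
    {v w : V} (hv : v ∈ G.BH (vertexSet P)) (hg : gap K G (vertexSet P) v ∉ P)
    (hw : w ∈ G.BH (vertexSet P)) (hg' : gap K G (vertexSet P) w ∉ P) : w = v := by
  obtain ⟨u, β, hβ, h⟩ := exists_ghostPath_of_gap_notMem hP hv hg hg'
  obtain rfl : β = [] := by
    by_contra hne
    exact h (ghostPath_mul_gap_mem hw.2.2.2 hne hβ)
  cases hβ
  by_contra hne
  refine h ?_
  rw [ghostPath, ← vtx_mul_gap hw.2.2.2, ← mul_assoc, vtx_mul_ne (Ne.symm hne), zero_mul]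
  exact P.zero_mem

theorem isMaximalTail_compl_vertexSet {P : TwoSidedIdeal (LPA K G)} (hP : IsPrimeTwoSided P) :
    G.IsMaximalTail (vertexSet P)ᶜ where
  nonempty := by
    by_contra h
    rw [Set.not_nonempty_iff_eq_empty, Set.compl_empty_iff] at h
    exact hP.1 (eq_top_of_vertexSet_eq_univ fun v => h ▸ trivial)
  mt1 _ _ hw h hv := hw (mem_vertexSet_of_reaches h hv)
  mt2 _ hv hne hfin := exists_rng_notMem_vertexSet hv hne hfin
  mt3 _ hv _ hw := exists_reaches_of_isPrime hP hv hw

/-- The classification of the prime ideals of the Leavitt path algebra. -/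
theorem ConditionK.isPrimeTwoSided_iff [Countable E] (hK : G.ConditionK)
    {P : TwoSidedIdeal (LPA K G)} : IsPrimeTwoSided P ↔
      (∃ M : Set V, G.IsMaximalTail M ∧ P = idealHS K G (G.Omega M) (G.BH (G.Omega M))) ∨
        ∃ v ∈ G.BV, P = idealHS K G (G.Omega {v}) (G.BH (G.Omega {v}) \ {v}) := by
  constructor
  swap
  · rintro (⟨M, hM, rfl⟩ | ⟨v, hv, rfl⟩)
    exacts [isPrimeTwoSided_of_isMaximalTail hK hM, isPrimeTwoSided_of_mem_BV hK hv]
  intro hP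
  have hPeq := hK.eq_idealHS P
  by_cases h : ∃ v ∈ G.BH (vertexSet P), gap K G (vertexSet P) v ∉ P
  · obtain ⟨v, hv, hg⟩ := h
    -- Vertices outside `P` reach `v`; vertices in `P` cannot, since everything they reach is in
    -- `P`.
    have hO : G.Omega {v} = vertexSet P := by
      ext w
      rw [mem_Omega_iff]
      constructor
      · intro h
        by_contra hw
        exact h v rfl (reaches_of_gap_notMem hP hv hg hw)
      · rintro hw _ rfl hr
        exact hv.1 (mem_vertexSet_of_reaches hr hw)
    have hS : gapSet P = G.BH (vertexSet P) \ {v} := by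
      ext w
      refine and_congr_right fun hw => ⟨?_, fun hne => ?_⟩
      · rintro hgw rfl
        exact hg hgw
      · by_contra hgw
        exact hne (eq_of_gap_notMem hP hv hg hw hgw)
    refine Or.inr ⟨v, ?_, ?_⟩
    · change v ∈ G.BH (G.Omega {v})
      rwa [hO]
    · rw [hO, ← hS]
      exact hPeq
  · push Not at h
    have hM := isMaximalTail_compl_vertexSet hP
    have hO : G.Omega (vertexSet P)ᶜ = vertexSet P := by
      ext w
      rw [← not_iff_not, hM.notMem_Omega, Set.mem_compl_iff]
    have hS : gapSet P = G.BH (vertexSet P) := by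
      ext w
      exact and_iff_left_of_imp (h w)
    refine Or.inl ⟨_, hM, ?_⟩
    rw [hO, ← hS]
    exact hPeq

/-! ### Simplicity -/

/-- Every proper ideal of a Leavitt path algebra is contained in a prime ideal. -/
theorem exists_isPrimeTwoSided_ge {J : TwoSidedIdeal (LPA K G)} (hJ : J ≠ ⊤) :
    ∃ P, IsPrimeTwoSided P ∧ J ≤ P := by
  obtain ⟨v, hv⟩ : ∃ v, v ∉ vertexSet J := by
    by_contra! h
    exact hJ (eq_top_of_vertexSet_eq_univ h)
  -- Without a unit, a union of a chain of proper ideals may be everything; omitting a fixed vertex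
  -- does pass to unions.
  obtain ⟨P, hJP, hP⟩ := zorn_le_nonempty₀ {I : TwoSidedIdeal (LPA K G) | vtx K G v ∉ I}
    (fun c hc hchain I₀ hI₀ => by
      let U : TwoSidedIdeal (LPA K G) := TwoSidedIdeal.mk' {x | ∃ I ∈ c, x ∈ I}
        ⟨I₀, hI₀, I₀.zero_mem⟩
        (by
          rintro x y ⟨I, hI, hx⟩ ⟨I', hI', hy⟩
          rcases hchain.total hI hI' with h | h
          · exact ⟨I', hI', I'.add_mem (h hx) hy⟩
          · exact ⟨I, hI, I.add_mem hx (h hy)⟩)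
        (by rintro x ⟨I, hI, hx⟩; exact ⟨I, hI, I.neg_mem hx⟩)
        (by rintro x y ⟨I, hI, hx⟩; exact ⟨I, hI, I.mul_mem_left _ _ hx⟩)
        (by rintro x y ⟨I, hI, hx⟩; exact ⟨I, hI, I.mul_mem_right _ _ hx⟩)
      have hU : ∀ {x}, x ∈ U ↔ ∃ I ∈ c, x ∈ I := by simp [U, TwoSidedIdeal.mem_mk']
      refine ⟨U, ?_, fun I hI x hx => hU.2 ⟨I, hI, hx⟩⟩
      intro h
      obtain ⟨I, hI, hvI⟩ := hU.1 h
      exact hc hI hvI) J hv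
  refine ⟨P, isPrimeTwoSided_of_idempotent (fun h => hP.prop (h ▸ trivial)) ?_, hJP⟩
  have key : ∀ J' : TwoSidedIdeal (LPA K G), ¬ J' ≤ P → ∃ j ∈ J', j - vtx K G v ∈ P := by
    intro J' hJ'
    have hmem : vtx K G v ∈ P ⊔ J' := by
      by_contra h
      exact hJ' (le_sup_right.trans (hP.le_of_ge h le_sup_left))
    obtain ⟨p, hp, j, hj, h⟩ := TwoSidedIdeal.mem_sup.1 hmem
    refine ⟨j, hj, ?_⟩
    rw [← h, sub_add_cancel_right]
    exact P.neg_mem hp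
  exact fun J₁ J₂ h₁ h₂ => ⟨_, vtx_mul_self v, hP.prop, key J₁ h₁, key J₂ h₂⟩

theorem idealHS_empty : idealHS K G ∅ ∅ = ⊥ := by
  rw [idealHS, Set.image_empty, Set.image_empty, Set.union_empty]
  exact le_bot_iff.1 (TwoSidedIdeal.span_le.2 (Set.empty_subset _))

/-- The pair H = S = ∅ is admissible, and I(∅,∅) contains no vertices. -/
theorem vtx_ne_zero [Countable E] (v : V) : vtx K G v ≠ 0 := by
  intro h
  have hH := (idealHS_spec (K := K) (G := G) (H := ∅) (S := ∅) (by simp)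
    (fun v _ hne _ => by obtain ⟨e, he⟩ := hne; exact ⟨e, he, by simp⟩) (by simp)).1
  have hv : v ∈ vertexSet (idealHS K G ∅ ∅) := by
    change vtx K G v ∈ idealHS K G ∅ ∅
    rw [h]
    exact TwoSidedIdeal.zero_mem _
  rw [hH] at hv
  exact hv

theorem ConditionK.isSimpleRing [Countable E] [Nonempty V] (hK : G.ConditionK)
    (hM : ∀ M : Set V, G.IsMaximalTail M → M = Set.univ) (hBV : G.BV = ∅) :
    IsSimpleRing (LPA K G) := by
  obtain ⟨v⟩ := ‹Nonempty V›
  have : Nontrivial (LPA K G) := ⟨_, _, vtx_ne_zero (K := K) (G := G) v⟩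
  refine ⟨{ eq_bot_or_eq_top := fun J => or_iff_not_imp_right.2 fun hJ => ?_ }⟩
  obtain ⟨P, hP, hJP⟩ := exists_isPrimeTwoSided_ge hJ
  have hO : G.Omega Set.univ = ∅ :=
    Set.eq_empty_of_forall_notMem fun w hw => hw.1 trivial
  rcases hK.isPrimeTwoSided_iff.1 hP with ⟨M, hMt, rfl⟩ | ⟨v, hv, -⟩
  · rw [hM M hMt, hO, BH_empty, idealHS_empty] at hJP
    exact le_bot_iff.1 hJP
  · simp [hBV] at hv

end Prime

end DirGraph

theorem corollary4p13 {V : Type u₁} {E : Type u₂} [Countable V] [Countable E]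
    (G : DirGraph V E) (hK : G.ConditionK) (K : Type u₃) [Field K] :
    {P : TwoSidedIdeal (DirGraph.LPA K G) | IsPrimeTwoSided P} =
        {P | ∃ M : Set V, G.IsMaximalTail M ∧
          P = DirGraph.idealHS K G (G.Omega M) (G.BH (G.Omega M))} ∪
        {P | ∃ v ∈ G.BV,
          P = DirGraph.idealHS K G (G.Omega {v}) (G.BH (G.Omega {v}) \ {v})} ∧
      (Nonempty V → (∀ M : Set V, G.IsMaximalTail M → M = Set.univ) → G.BV = ∅ →
        IsSimpleRing (DirGraph.LPA K G) ∧ ∃ x y : DirGraph.LPA K G, x * y ≠ 0) := by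
  refine ⟨Set.ext fun P => hK.isPrimeTwoSided_iff, fun hV hM hBV => ⟨hK.isSimpleRing hM hBV, ?_⟩⟩
  obtain ⟨v⟩ := hV
  exact ⟨_, _, (DirGraph.vtx_mul_self (K := K) (G := G) v).trans_ne (DirGraph.vtx_ne_zero v)⟩
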